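/- Let $k\ge 3$ and $n_1\ge n_2\ge\dots\ge n_k\ge 1$ be integers, and let $G=K_{n_1,\dots,n_k}$ be the complete $k$-partite graph with partite sets $U_i=\{u_i^1,\dots,u_i^{n_i}\}$, $1\le i\le k$. An edge-coloring of $G$ is a map $c:E(G)\to\mathbb N$; a subgraph is rainbow if its edges have pairwise different colors. Let $\mathrm{ar}(G,K_k)$ be the maximum number of colors in an edge-coloring of $G$ without a rainbow copy of $K_k$; a coloring without rainbow $K_k$ that uses exactly $\mathrm{ar}(G,K_k)$ colors is called extremal. Two edge-colored graphs are isomorphic if there are a graph isomorphism $\rho$ and a bijection $\sigma$ between the sets of colors used such that for every edge $uv$ of color $a$ the edge $\rho(u)\rho(v)$ has color $\sigma(a)$. A book coloring of the book $B_m=K_{m,1,1}$, with vertices $x,y,z_1,\dots,z_m$ and triangles $xyz_i$ ($1\le i\le m$), is a coloring $c$ for which there are distinct colors $a_0,a_1,\dots,a_m$ such that $c(xy)=a_0$ and, for every $i$, the pair $(c(xz_i),c(yz_i))$ is one of $(a_i,a_i)$, $(a_i,a_0)$, $(a_0,a_i)$. Then every extremal coloring of $G$ for $\mathrm{ar}(G,K_k)$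 is isomorphic to a coloring $c$ of $G$ that satisfies one of the following. (1) $k\ge 4$, $n_{k-3}=1$, and any two distinct edges have distinct colors, with the only exception $c(u_{k-3}^1u_{k-2}^1)=c(u_{k-1}^1u_k^1)$. (2) $n_{k-1}=1$, the subgraph induced by $U_{k-2}\cup U_{k-1}\cup U_k$, which is a book $B_{n_{k-2}}$, carries a book coloring, and any two distinct edges of $G$ have distinct colors unless both lie in this book. (3) For every vertex $u_k^s\in U_k$ there are two partite sets $U_i,U_j$ with $1\le i<j<k$ (depending on $s$) and $n_i+n_j=n_{k-2}+n_{k-1}$ such that all edges between $u_k^s$ and $U_i\cup U_j$ have the same color; apart from these coincidences, all edges of $G$ have distinct colors. -/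

import Mathlib

namespace AntiRamsey

open SimpleGraph

/-- The number of colors `|C(G)|` used by an edge-coloring `c : E(G) → ℕ`. -/
noncomputable def numColors {V : Type} {G : SimpleGraph V} (c : G.EdgeLabeling ℕ) : ℕ :=
  (Set.range c).ncard

/-- The colored graph `G` contains a rainbow copy of `H`: a (not necessarily induced) copy of `H`
in `G`, all of whose edges have different colors. -/
def HasRainbow {V W : Type} {G : SimpleGraph V} (c : G.EdgeLabeling ℕ) (H : SimpleGraph W) : Prop :=
  ∃ f : Copy H G, Function.Injective fun e : H.edgeSet => c (f.mapEdgeSet e)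

/-- The anti-Ramsey number `ar(G, H)`. -/
noncomputable def ar {V W : Type} (G : SimpleGraph V) (H : SimpleGraph W) : ℕ :=
  sSup {m | ∃ c : G.EdgeLabeling ℕ, ¬ HasRainbow c H ∧ numColors c = m}

/-- `c` is an extremal coloring for `ar(G, H)`. -/
def IsExtremal {V W : Type} {G : SimpleGraph V} (c : G.EdgeLabeling ℕ) (H : SimpleGraph W) : Prop :=
  ¬ HasRainbow c H ∧ numColors c = ar G H

/-- Isomorphism of edge-colored graphs: a graph isomorphism together with a bijection between the
sets of colors that are used. -/
def ColoredIso {V₁ V₂ : Type} {G₁ : SimpleGraph V₁} {G₂ : SimpleGraph V₂}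
    (c₁ : G₁.EdgeLabeling ℕ) (c₂ : G₂.EdgeLabeling ℕ) : Prop :=
  ∃ (ρ : G₁ ≃g G₂) (σ : Set.range c₁ ≃ Set.range c₂),
    ∀ e : G₁.edgeSet, (σ ⟨c₁ e, Set.mem_range_self e⟩ : ℕ) = c₂ (ρ.mapEdgeSet e)

/-- The complete multipartite graph `K_{n_1,…,n_k}`. The partite set `U_i` consists of the vertices
`⟨i, s⟩` (indices start from `0` in `Fin k`). -/
abbrev multipartite {k : ℕ} (n : Fin k → ℕ) : SimpleGraph (Σ i : Fin k, Fin (n i)) :=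
  completeMultipartiteGraph fun i : Fin k => Fin (n i)

/-- The index that is written `k - j` when the partite sets are numbered `1, …, k`. -/
def fromEnd {k : ℕ} (j : ℕ) (hj : j < k) : Fin k := Fin.rev ⟨j, hj⟩

/-- Vertices of the book: the two vertices `x, y` of the spine and the vertices `z_1, …, z_m`. -/
inductive BookVertex (m : ℕ) : Type
  | x : BookVertex m
  | y : BookVertex m
  | z (i : Fin m) : BookVertex m

/-- The book `B_m = K_{m,1,1}`: the `m` triangles `x y z_i` sharing the edge `x y`. -/
def book (m : ℕ) : SimpleGraph (BookVertex m) where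
  Adj
    | .x, .y => True
    | .y, .x => True
    | .x, .z _ => True
    | .z _, .x => True
    | .y, .z _ => True
    | .z _, .y => True
    | _, _ => False
  symm := ⟨by rintro (_ | _ | _) (_ | _ | _) <;> simp⟩
  loopless := ⟨by rintro (_ | _ | _) <;> simp⟩

/-- The extremal book colorings: with distinct colors `a_0, …, a_m`, the edge `x y` has color
`a_0`, and `(c(x z_i), c(y z_i))` is one of `(a_i, a_i)`, `(a_i, a_0)`, `(a_0, a_i)`. -/
def IsBookColoring {m : ℕ} (c : (book m).EdgeLabeling ℕ) : Prop :=
  ∃ (a₀ : ℕ) (a : Fin m → ℕ), Function.Injective a ∧ (∀ i, a i ≠ a₀) ∧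
    c.get .x .y trivial = a₀ ∧
    ∀ i : Fin m,
      (c.get .x (.z i) trivial = a i ∧ c.get .y (.z i) trivial = a i) ∨
      (c.get .x (.z i) trivial = a i ∧ c.get .y (.z i) trivial = a₀) ∨
      (c.get .x (.z i) trivial = a₀ ∧ c.get .y (.z i) trivial = a i)

section Types

variable {k : ℕ} {n : Fin k → ℕ}

/-- The first vertex of the partite set `U_{k-j}` (in the numbering `1, …, k`). -/
def firstVertex (hpos : ∀ i, 0 < n i) (j : ℕ) (hj : j < k) : Σ i : Fin k, Fin (n i) :=
  ⟨fromEnd j hj, ⟨0, hpos _⟩⟩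

/-- First type: `k ≥ 4`, `n_{k-3} = 1`, and the only two distinct edges of the same color are
`u_{k-3} u_{k-2}` and `u_{k-1} u_k`. -/
def IsType1 (hpos : ∀ i, 0 < n i) (c : (multipartite n).EdgeLabeling ℕ) : Prop :=
  ∃ hk : 4 ≤ k, n (fromEnd 3 (by omega)) = 1 ∧
    ∀ e f : (multipartite n).edgeSet, c e = c f ↔
      e = f ∨
      ((e : Sym2 _) = s(firstVertex hpos 3 (by omega), firstVertex hpos 2 (by omega)) ∧
        (f : Sym2 _) = s(firstVertex hpos 1 (by omega), firstVertex hpos 0 (by omega))) ∨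
      ((f : Sym2 _) = s(firstVertex hpos 3 (by omega), firstVertex hpos 2 (by omega)) ∧
        (e : Sym2 _) = s(firstVertex hpos 1 (by omega), firstVertex hpos 0 (by omega)))

/-- The vertices of the last three partite sets `U_{k-2} ∪ U_{k-1} ∪ U_k`. -/
def lastThree (hk : 3 ≤ k) : Set (Σ i : Fin k, Fin (n i)) :=
  {v | v.1 = fromEnd 2 (by omega) ∨ v.1 = fromEnd 1 (by omega) ∨ v.1 = fromEnd 0 (by omega)}

/-- Second type: `n_{k-1} = 1`, the subgraph induced by the last three partite sets is the book
with `n_{k-2}` triangles, colored by an extremal book coloring, and two distinct edges have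
distinct colors unless they are both in that book. -/
def IsType2 (hk : 3 ≤ k) (c : (multipartite n).EdgeLabeling ℕ) : Prop :=
  n (fromEnd 1 (by omega)) = 1 ∧
  ∃ φ : book (n (fromEnd 2 (by omega))) ↪g multipartite n,
    Set.range φ = lastThree hk ∧
    IsBookColoring (c.pullback φ.toHom) ∧
    ∀ e f : (multipartite n).edgeSet, c e = c f →
      e = f ∨ ((∀ v ∈ (e : Sym2 _), v ∈ Set.range φ) ∧ (∀ v ∈ (f : Sym2 _), v ∈ Set.range φ))

/-- The edges between the vertex `u` and `U_i ∪ U_j`. -/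
def edgesTo (u : Σ i : Fin k, Fin (n i)) (i j : Fin k) : Set (Sym2 (Σ i : Fin k, Fin (n i))) :=
  {e | ∃ v, (v.1 = i ∨ v.1 = j) ∧ e = s(u, v)}

/-- Third type: to every vertex `u` of `U_k` there are assigned two partite sets `U_i, U_j`,
`i < j < k`, with `n_i + n_j = n_{k-2} + n_{k-1}`, such that the edges between `u` and `U_i ∪ U_j`
have the same color; apart from that, all edges have distinct colors. -/
def IsType3 (hk : 3 ≤ k) (c : (multipartite n).EdgeLabeling ℕ) : Prop :=
  ∃ i j : Fin (n (fromEnd 0 (by omega))) → Fin k,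
    (∀ s, i s < j s ∧ j s < fromEnd 0 (by omega) ∧
      n (i s) + n (j s) = n (fromEnd 2 (by omega)) + n (fromEnd 1 (by omega))) ∧
    ∀ e f : (multipartite n).edgeSet, c e = c f ↔
      e = f ∨ ∃ s, (e : Sym2 _) ∈ edgesTo ⟨fromEnd 0 (by omega), s⟩ (i s) (j s) ∧
        (f : Sym2 _) ∈ edgesTo ⟨fromEnd 0 (by omega), s⟩ (i s) (j s)

end Types

end AntiRamsey

/-! Choose a transversal, one vertex in each partite set, uniformly at random. It spans a `K_k`, so
if no `K_k` is rainbow, some color class `F` contains two edges of it. Put `N = n_k (n_{k-2} +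
n_{k-1} - 1)`. The core of the proof is that a color class `F` contains two edges of a random
transversal with probability at most `(|F| - 1) / N`. Summing over the classes gives `1 ≤ ∑ P(F) ≤
(|E| - |C|) / N`, where `|C|` is the number of colors. An explicit coloring (`exists_coloring`)
shows that an extremal coloring has `|E| - |C| ≤ N`. Hence everything is tight (`tight_of_bound`):
every class attains its bound, and every transversal is hit twice by exactly one color.

It remains to find the tight classes with at least two edges and to fit them together. If `n_{k-1} ≥
2`, `class_bound` shows that they are full stars: all edges from one vertex of a part of size `n_k`
to two parts of total size `n_{k-2} + n_{k-1}`. Its proof conditions on the vertex in the smallest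
part. The edges of `F` at that vertex become a set of vertices to be hit, the edges avoiding the
part remain edges, and `mean_two_le_vcount_le` and `mixed_bound` treat the resulting pure and mixed
problems. As no transversal is hit twice by two colors, the centers of the stars fill exactly one
part, which is type 3.

If `n_{k-1} = 1`, then `N = n_{k-2}` and `unit_bound` is a union bound after one edge is discarded.
For `n_{k-2} ≥ 2` the tight classes live in a single book (`book_class`, `exists_book`), which is
type 2. For `n_{k-2} = 1` only one color is lost, through two edges lying on all transversals; they
are disjoint (type 1) or share a vertex (type 3). -/

namespace AntiRamsey

open Finset SimpleGraph

set_option linter.unusedSectionVars false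

/-! ### Random transversals: expectations, independence and union bounds. -/

section Transversals

variable {ι : Type} [Fintype ι] [DecidableEq ι] {n : ι → ℕ}

open scoped Classical in
/-- The indicator of a proposition. -/
noncomputable def ind (p : Prop) : ℕ := if p then 1 else 0

theorem ind_of {p : Prop} (h : p) : ind p = 1 := if_pos h

theorem ind_not {p : Prop} (h : ¬ p) : ind p = 0 := if_neg h

theorem ind_le_one (p : Prop) : ind p ≤ 1 := by
  by_cases h : p <;> simp [ind, h]

theorem ind_eq_one {p : Prop} : ind p = 1 ↔ p := by
  by_cases h : p <;> simp [ind, h]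

/-- The average over all transversals of a complete multipartite graph. -/
noncomputable def mean (f : (∀ i, Fin (n i)) → ℚ) : ℚ :=
  (∑ t, f t) / Fintype.card (∀ i, Fin (n i))

theorem mean_add (f g : (∀ i, Fin (n i)) → ℚ) :
    mean (fun t => f t + g t) = mean f + mean g := by
  simp [mean, sum_add_distrib, add_div]

theorem mean_sub (f g : (∀ i, Fin (n i)) → ℚ) :
    mean (fun t => f t - g t) = mean f - mean g := by
  simp [mean, sum_sub_distrib, sub_div]

theorem mean_const_mul (r : ℚ) (f : (∀ i, Fin (n i)) → ℚ) :
    mean (fun t => r * f t) = r * mean f := by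
  simp [mean, ← mul_sum, mul_div_assoc]

theorem mean_sum {α : Type*} (s : Finset α) (f : α → (∀ i, Fin (n i)) → ℚ) :
    mean (fun t => ∑ x ∈ s, f x t) = ∑ x ∈ s, mean (f x) := by
  simp only [mean]
  rw [sum_comm, sum_div]

theorem card_transversals_pos (hpos : ∀ i, 0 < n i) :
    (0 : ℚ) < Fintype.card (∀ i, Fin (n i)) := by
  have : Nonempty (∀ i, Fin (n i)) := ⟨fun i => ⟨0, hpos i⟩⟩
  exact_mod_cast Fintype.card_pos

theorem mean_const (hpos : ∀ i, 0 < n i) (r : ℚ) :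
    mean (fun _ : ∀ i, Fin (n i) => r) = r := by
  have := card_transversals_pos hpos
  simp only [mean, sum_const, card_univ, nsmul_eq_mul]
  field_simp

theorem mean_mono {f g : (∀ i, Fin (n i)) → ℚ} (h : ∀ t, f t ≤ g t) : mean f ≤ mean g := by
  unfold mean
  gcongr with t
  exact h t

theorem mean_nonneg {f : (∀ i, Fin (n i)) → ℚ} (h : ∀ t, 0 ≤ f t) : 0 ≤ mean f := by
  unfold mean
  exact div_nonneg (sum_nonneg fun t _ => h t) (by positivity)

/-- Every transversal has positive weight, so a pointwise inequality whose means agree is an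
equality everywhere. This is how each equality case below is turned into a combinatorial statement.
-/
theorem eq_of_mean_le (hpos : ∀ i, 0 < n i) {f g : (∀ i, Fin (n i)) → ℚ} (h : ∀ t, f t ≤ g t)
    (hm : mean g ≤ mean f) (t : ∀ i, Fin (n i)) : f t = g t := by
  have hc := card_transversals_pos hpos
  unfold mean at hm
  rw [div_le_div_iff_of_pos_right hc] at hm
  have := le_antisymm (sum_le_sum fun t _ => h t) hm
  exact (sum_eq_sum_iff_of_le fun t _ => h t).1 this t (mem_univ t)

/-- A coordinate of a uniformly random transversal is independent of the other coordinates. -/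
theorem mean_ind_mul (hpos : ∀ i, 0 < n i) (i : ι) (x : Fin (n i)) (g : (∀ i, Fin (n i)) → ℚ)
    (hg : ∀ t y, g (Function.update t i y) = g t) :
    mean (fun t => (ind (t i = x) : ℚ) * g t) = mean g / n i := by
  -- Exchanging the values `x` and `y` in coordinate `i` is an involution on transversals that
  -- leaves `g` unchanged, so all values of the coordinate contribute equally.
  have key : ∀ y, ∑ t, (ind (t i = y) : ℚ) * g t = ∑ t, (ind (t i = x) : ℚ) * g t := by
    intro y
    refine sum_nbij' (fun t => Function.update t i (Equiv.swap x y (t i)))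
      (fun t => Function.update t i (Equiv.swap x y (t i))) (by simp) (by simp) (by simp)
      (by simp) ?_
    intro t _
    have : Function.update t i (Equiv.swap x y (t i)) i = x ↔ t i = y := by
      rw [Function.update_self, Equiv.swap_apply_eq_iff, Equiv.swap_apply_left]
    simp only [hg, this]
  have tot : ∑ y, ∑ t, (ind (t i = y) : ℚ) * g t = ∑ t, g t := by
    rw [sum_comm]
    refine sum_congr rfl fun t _ => ?_
    rw [← sum_mul]
    simp [ind]
  simp only [key, sum_const, card_univ, Fintype.card_fin, nsmul_eq_mul] at tot
  have : (n i : ℚ) ≠ 0 := by exact_mod_cast (hpos i).ne'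
  unfold mean
  rw [← tot]
  field_simp

/-- The number of vertices of `S` on the transversal `t`. -/
noncomputable def vcount (S : Finset (Σ i, Fin (n i))) (t : ∀ i, Fin (n i)) : ℕ :=
  ∑ v ∈ S, ind (t v.1 = v.2)

/-- The number of edges of `F` that are spanned by the transversal `t`. -/
noncomputable def ecount (F : Finset (Sym2 (Σ i, Fin (n i)))) (t : ∀ i, Fin (n i)) : ℕ :=
  ∑ e ∈ F, ind (∀ v ∈ e, t v.1 = v.2)

/-- The edges in `F` join different partite sets. -/
def Crossing (F : Finset (Sym2 (Σ i, Fin (n i)))) : Prop :=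
  ∀ v w, s(v, w) ∈ F → v.1 ≠ w.1

theorem vcount_update {S : Finset (Σ i, Fin (n i))} {i : ι} (hS : ∀ v ∈ S, v.1 ≠ i)
    (t : ∀ i, Fin (n i)) (y : Fin (n i)) : vcount S (Function.update t i y) = vcount S t := by
  refine sum_congr rfl fun v hv => ?_
  rw [Function.update_of_ne (hS v hv)]

theorem ecount_update {F : Finset (Sym2 (Σ i, Fin (n i)))} {i : ι}
    (hF : ∀ e ∈ F, ∀ v ∈ e, v.1 ≠ i) (t : ∀ i, Fin (n i)) (y : Fin (n i)) :
    ecount F (Function.update t i y) = ecount F t := by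
  refine sum_congr rfl fun e he => ?_
  congr 1
  refine propext (forall₂_congr fun v hv => ?_)
  rw [Function.update_of_ne (hF e he v hv)]

theorem mean_vcount_mul (hpos : ∀ i, 0 < n i) {S : Finset (Σ i, Fin (n i))} {i : ι}
    (hS : ∀ v ∈ S, v.1 = i) (g : (∀ i, Fin (n i)) → ℚ)
    (hg : ∀ t y, g (Function.update t i y) = g t) :
    mean (fun t => (vcount S t : ℚ) * g t) = #S / n i * mean g := by
  simp only [vcount, Nat.cast_sum, sum_mul, mean_sum]
  rw [sum_congr rfl (g := fun _ => mean g / n i), sum_const, nsmul_eq_mul]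
  · ring
  · rintro ⟨j, x⟩ hv
    obtain rfl : j = i := hS _ hv
    exact mean_ind_mul hpos j x g hg

theorem mean_ind_vertex (hpos : ∀ i, 0 < n i) (v : Σ i, Fin (n i)) :
    mean (fun t => (ind (t v.1 = v.2) : ℚ)) = 1 / n v.1 := by
  have := mean_ind_mul hpos v.1 v.2 (fun _ => 1) (fun _ _ => rfl)
  simpa [mean_const hpos] using this

theorem mean_ind_edge (hpos : ∀ i, 0 < n i) {v w : Σ i, Fin (n i)} (h : v.1 ≠ w.1) :
    mean (fun t => (ind (∀ u ∈ s(v, w), t u.1 = u.2) : ℚ)) = 1 / (n v.1 * n w.1) := by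
  have := mean_ind_mul hpos v.1 v.2 (fun t => (ind (t w.1 = w.2) : ℚ))
    (fun t y => by rw [Function.update_of_ne h.symm])
  rw [mean_ind_vertex hpos] at this
  rw [mul_comm, ← div_div, ← this]
  congr 1
  ext t
  by_cases h1 : t v.1 = v.2 <;> by_cases h2 : t w.1 = w.2 <;> simp [ind, h1, h2]

theorem mean_vcount (hpos : ∀ i, 0 < n i) (S : Finset (Σ i, Fin (n i))) :
    mean (fun t => (vcount S t : ℚ)) = ∑ v ∈ S, 1 / (n v.1 : ℚ) := by
  simp only [vcount, Nat.cast_sum, mean_sum, mean_ind_vertex hpos]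

theorem mean_vcount_le (hpos : ∀ i, 0 < n i) {S : Finset (Σ i, Fin (n i))} {m : ℕ} (hm : 0 < m)
    (hS : ∀ v ∈ S, m ≤ n v.1) : mean (fun t => (vcount S t : ℚ)) ≤ #S / m := by
  rw [mean_vcount hpos, div_eq_mul_one_div, ← nsmul_eq_mul]
  refine sum_le_card_nsmul _ _ _ fun v hv => ?_
  have : (0 : ℚ) < m := by exact_mod_cast hm
  gcongr
  exact hS v hv

theorem mean_ecount (F : Finset (Sym2 (Σ i, Fin (n i)))) :
    mean (fun t => (ecount F t : ℚ)) =
      ∑ e ∈ F, mean (fun t => (ind (∀ u ∈ e, t u.1 = u.2) : ℚ)) := by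
  simp only [ecount, Nat.cast_sum, mean_sum]

/-- A crossing edge lies on a random transversal with probability the inverse of the product of the
sizes of its two parts; the rest is linearity of expectation. -/
theorem mean_ecount_le (hpos : ∀ i, 0 < n i) {F : Finset (Sym2 (Σ i, Fin (n i)))} {m : ℕ}
    (hm : 0 < m) (hF : Crossing F) (h : ∀ v w, s(v, w) ∈ F → m ≤ n v.1 * n w.1) :
    mean (fun t => (ecount F t : ℚ)) ≤ #F / m := by
  rw [mean_ecount, div_eq_mul_one_div, ← nsmul_eq_mul]
  refine sum_le_card_nsmul _ _ _ fun e he => ?_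
  induction e with | _ v w =>
  rw [mean_ind_edge hpos (hF v w he)]
  have : (0 : ℚ) < m := by exact_mod_cast hm
  gcongr
  exact_mod_cast h v w he

theorem vcount_filter_add (S : Finset (Σ i, Fin (n i))) (i : ι) (t : ∀ i, Fin (n i)) :
    vcount (S.filter (·.1 = i)) t + vcount (S.filter (¬ ·.1 = i)) t = vcount S t :=
  sum_filter_add_sum_filter_not _ _ _

theorem sum_ind_eq_card {α : Type*} (s : Finset α) (p : α → Prop) [DecidablePred p] :
    ∑ x ∈ s, ind (p x) = #(s.filter p) := by
  rw [card_filter]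
  exact sum_congr rfl fun x _ => by by_cases h : p x <;> simp [ind, h]

theorem one_le_sum_ind {α : Type*} {s : Finset α} {p : α → Prop} :
    1 ≤ ∑ x ∈ s, ind (p x) ↔ ∃ x ∈ s, p x := by
  classical
  rw [sum_ind_eq_card, Nat.one_le_iff_ne_zero, card_ne_zero, filter_nonempty_iff]

theorem vcount_pos {S : Finset (Σ i, Fin (n i))} {t : ∀ i, Fin (n i)} :
    1 ≤ vcount S t ↔ ∃ v ∈ S, t v.1 = v.2 :=
  one_le_sum_ind

theorem ecount_pos {F : Finset (Sym2 (Σ i, Fin (n i)))} {t : ∀ i, Fin (n i)} :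
    1 ≤ ecount F t ↔ ∃ e ∈ F, ∀ v ∈ e, t v.1 = v.2 :=
  one_le_sum_ind

theorem two_le_ecount {F : Finset (Sym2 (Σ i, Fin (n i)))} {t : ∀ i, Fin (n i)}
    {e f : Sym2 (Σ i, Fin (n i))} (he : e ∈ F) (hf : f ∈ F) (hef : e ≠ f)
    (het : ∀ v ∈ e, t v.1 = v.2) (hft : ∀ v ∈ f, t v.1 = v.2) : 2 ≤ ecount F t := by
  classical
  calc 2 = ∑ e ∈ ({e, f} : Finset _), ind (∀ v ∈ e, t v.1 = v.2) := by
        rw [sum_pair hef, ind_of het, ind_of hft]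
    _ ≤ _ := sum_le_sum_of_subset (by simp [insert_subset_iff, he, hf])

theorem exists_of_two_le_ecount {F : Finset (Sym2 (Σ i, Fin (n i)))} {t : ∀ i, Fin (n i)}
    (h : 2 ≤ ecount F t) : ∃ e ∈ F, ∃ f ∈ F, e ≠ f ∧ (∀ v ∈ e, t v.1 = v.2) ∧
      ∀ v ∈ f, t v.1 = v.2 := by
  classical
  rw [ecount, sum_ind_eq_card] at h
  obtain ⟨e, he, f, hf, hef⟩ := one_lt_card.1 h
  rw [mem_filter] at he hf
  exact ⟨e, he.1, f, hf.1, hef, he.2, hf.2⟩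

theorem vcount_le_one {S : Finset (Σ i, Fin (n i))} {i : ι} (hS : ∀ v ∈ S, v.1 = i)
    (t : ∀ i, Fin (n i)) : vcount S t ≤ 1 := by
  classical
  calc vcount S t ≤ ∑ v ∈ S, ind (v = ⟨i, t i⟩) := by
        refine sum_le_sum fun v hv => ?_
        obtain ⟨j, x⟩ := v
        obtain rfl : j = i := hS _ hv
        by_cases h : t j = x
        · rw [ind_of h, ind_of (by rw [← h])]
        · rw [ind_not h]; exact Nat.zero_le _
    _ ≤ 1 := by
        rw [sum_ind_eq_card]
        refine card_le_one.2 fun v hv w hw => ?_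
        rw [(mem_filter.1 hv).2, (mem_filter.1 hw).2]

end Transversals

/-! ### Probability that a transversal picks two vertices of a given set. -/

section VertexBound

variable {ι : Type} [Fintype ι] [DecidableEq ι] {n : ι → ℕ}

/-- The form needed to use independence: in each product `x` counts vertices in one part and `y`
counts vertices elsewhere, so `mean_vcount_mul` factors the means. -/
theorem ind_two_le_add {x y : ℕ} (hx : x ≤ 1) :
    (ind (2 ≤ x + y) : ℚ) = x * ind (1 ≤ y) + (ind (2 ≤ y) - x * ind (2 ≤ y)) := by
  interval_cases x
  · simp
  · have : (2 ≤ 1 + y) = (1 ≤ y) := by rw [eq_iff_iff]; omega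
    simp [this]

theorem ind_le_vcount (S : Finset (Σ i, Fin (n i))) (t : ∀ i, Fin (n i)) :
    (ind (1 ≤ vcount S t) : ℚ) ≤ vcount S t := by
  by_cases h : 1 ≤ vcount S t
  · rw [ind_of h]; exact_mod_cast h
  · rw [ind_not h]; positivity

theorem mean_ind_le_one (hpos : ∀ i, 0 < n i) (p : (∀ i, Fin (n i)) → Prop) :
    mean (fun t => (ind (p t) : ℚ)) ≤ 1 := by
  rw [← mean_const hpos 1]
  exact mean_mono fun t => by exact_mod_cast ind_le_one _

/-- Splitting off the vertices of `S` in one partite set. -/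
theorem mean_two_le_vcount (hpos : ∀ i, 0 < n i) (S : Finset (Σ i, Fin (n i))) (i : ι) :
    mean (fun t => (ind (2 ≤ vcount S t) : ℚ)) =
      #(S.filter (·.1 = i)) / n i * mean (fun t => (ind (1 ≤ vcount (S.filter (¬ ·.1 = i)) t) : ℚ))
      + (mean (fun t => (ind (2 ≤ vcount (S.filter (¬ ·.1 = i)) t) : ℚ)) -
        #(S.filter (·.1 = i)) / n i *
          mean (fun t => (ind (2 ≤ vcount (S.filter (¬ ·.1 = i)) t) : ℚ))) := by
  have h1 : ∀ v ∈ S.filter (·.1 = i), v.1 = i := fun v hv => (mem_filter.1 hv).2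
  have h2 : ∀ v ∈ S.filter (¬ ·.1 = i), v.1 ≠ i := fun v hv => (mem_filter.1 hv).2
  rw [← mean_vcount_mul hpos h1 _ fun t y => by rw [vcount_update h2],
    ← mean_vcount_mul hpos h1 _ fun t y => by rw [vcount_update h2], ← mean_sub, ← mean_add]
  congr 1
  ext t
  rw [← ind_two_le_add (vcount_le_one h1 t), vcount_filter_add]

/-- If `M ≤ |O| + n_i`, the trivial bound 1 for the probability suffices. Otherwise `m = M - n_i`
exceeds `|O|`, every part that meets `O` has at least `m` vertices, and the union bound `|O| / m`
suffices because `|O| (n_i - 1) ≤ m (n_i - 1)`. -/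
theorem mean_one_le_vcount_bound (hpos : ∀ i, 0 < n i) {O : Finset (Σ i, Fin (n i))} {M : ℕ} {i : ι}
    (hO : O.Nonempty) (hM : ∀ v ∈ O, M ≤ n i + n v.1) :
    mean (fun t => (ind (1 ≤ vcount O t) : ℚ)) * (M - 1) ≤ #O + n i - 1 := by
  have hi : (1 : ℚ) ≤ n i := by exact_mod_cast hpos i
  have ho : (1 : ℚ) ≤ #O := by exact_mod_cast hO.card_pos
  have h0 : 0 ≤ mean (fun t => (ind (1 ≤ vcount O t) : ℚ)) := mean_nonneg fun t => by positivity
  have h1 := mean_ind_le_one hpos fun t => 1 ≤ vcount O t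
  rcases le_or_gt M (#O + n i) with h | h
  · have : (M : ℚ) ≤ #O + n i := by exact_mod_cast h
    nlinarith
  · obtain ⟨m, rfl⟩ : ∃ m, M = n i + m := ⟨M - n i, by omega⟩
    have hm : #O < m := by omega
    have hm' : (#O : ℚ) < m := by exact_mod_cast hm
    have h2 : mean (fun t => (ind (1 ≤ vcount O t) : ℚ)) ≤ #O / m :=
      (mean_mono (ind_le_vcount O)).trans
        (mean_vcount_le hpos (by omega) fun v hv => by have := hM v hv; omega)
    rw [le_div_iff₀ (by linarith)] at h2
    push_cast
    nlinarith

/-- A transversal picks two vertices of `S` with probability at most `(|S| - 1) / (M - 1)`, where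
`M` bounds from below the total size of two partite sets that meet `S`. -/
theorem mean_two_le_vcount_le (hpos : ∀ i, 0 < n i) (M : ℕ) (S : Finset (Σ i, Fin (n i)))
    (hS : S.Nonempty) (hM : ∀ v ∈ S, ∀ w ∈ S, v.1 ≠ w.1 → M ≤ n v.1 + n w.1) :
    mean (fun t => (ind (2 ≤ vcount S t) : ℚ)) * (M - 1) ≤ #S - 1 := by
  induction hs : #S using Nat.strong_induction_on generalizing S with | _ s ih =>
  obtain ⟨v, hv⟩ := hS
  rw [← hs]
  have hcard : #(S.filter (·.1 = v.1)) + #(S.filter (¬ ·.1 = v.1)) = #S :=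
    card_filter_add_card_filter_not _
  have hp : 0 < #(S.filter (·.1 = v.1)) := card_pos.2 ⟨v, by simp [hv]⟩
  have hle : #(S.filter (·.1 = v.1)) ≤ n v.1 := by
    calc #(S.filter (·.1 = v.1)) ≤ #(univ.map (Function.Embedding.sigmaMk (β := fun i => Fin (n i)) v.1)) :=
          card_le_card fun w hw => by
            obtain ⟨j, x⟩ := w
            obtain rfl : j = v.1 := (mem_filter.1 hw).2
            simp
      _ = _ := by simp
  rw [mean_two_le_vcount hpos S v.1]
  rcases (S.filter (¬ ·.1 = v.1)).eq_empty_or_nonempty with h0 | h0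
  · have : (1 : ℚ) ≤ #S := by exact_mod_cast card_pos.2 ⟨v, hv⟩
    simp only [h0, vcount, sum_empty]
    simp [ind, mean, this]
  · have e1 := mean_one_le_vcount_bound hpos (M := M) (i := v.1) h0 fun w hw =>
      hM v hv w (mem_filter.1 hw).1 (Ne.symm (mem_filter.1 hw).2)
    have e2 := ih _ (by omega) _ h0 (fun u hu w hw =>
      hM u (mem_filter.1 hu).1 w (mem_filter.1 hw).1) rfl
    have hn : (0 : ℚ) < n v.1 := by exact_mod_cast hpos _
    set A := mean (fun t => (ind (1 ≤ vcount (S.filter (¬ ·.1 = v.1)) t) : ℚ))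
    set B := mean (fun t => (ind (2 ≤ vcount (S.filter (¬ ·.1 = v.1)) t) : ℚ))
    set o := #(S.filter (¬ ·.1 = v.1))
    set p := #(S.filter (·.1 = v.1))
    have hq : (0 : ℚ) ≤ p / n v.1 := by positivity
    have hq1 : (p : ℚ) / n v.1 ≤ 1 := by
      rw [div_le_one hn]; exact_mod_cast hle
    have hs' : (#S : ℚ) = p / n v.1 * n v.1 + o := by
      rw [← hcard]; push_cast; field_simp
    -- With `q = p / n_i` the probability is `q A + (1 - q) B`. The two estimates combine to `q (o +
    -- n_i - 1) + (1 - q) (o - 1) = o + p - 1`, which is exactly `|S| - 1`.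
    rw [hs']
    nlinarith [mul_le_mul_of_nonneg_left e1 hq, mul_le_mul_of_nonneg_left e2 (sub_nonneg.2 hq1)]

/-- Vertices outside `O`, one from each part, would form a transversal that misses `O`. -/
theorem exists_full_part (O : Finset (Σ i, Fin (n i))) (hpos : ∀ i, 0 < n i)
    (h : 1 ≤ mean (fun t => (ind (1 ≤ vcount O t) : ℚ))) : ∃ j, ∀ x, (⟨j, x⟩ : Σ i, Fin (n i)) ∈ O := by
  by_contra! hcon
  choose t ht using hcon
  have := eq_of_mean_le hpos (f := fun t => (ind (1 ≤ vcount O t) : ℚ)) (g := fun _ => 1)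
    (fun t => by exact_mod_cast ind_le_one _) (by rwa [mean_const hpos]) t
  have h1 : ind (1 ≤ vcount O t) = 1 := by exact_mod_cast this
  obtain ⟨v, hv, hvt⟩ := vcount_pos.1 (ind_eq_one.1 h1)
  apply ht v.1
  rw [hvt]
  exact hv

theorem card_part (j : ι) : #(univ.filter fun v : Σ i, Fin (n i) => v.1 = j) = n j := by
  have : (univ.filter fun v : Σ i, Fin (n i) => v.1 = j) =
      univ.map (Function.Embedding.sigmaMk (β := fun i => Fin (n i)) j) := by
    ext ⟨i, x⟩
    simp only [mem_filter, mem_univ, true_and, mem_map, Function.Embedding.sigmaMk_apply]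
    constructor
    · rintro rfl; exact ⟨x, rfl⟩
    · rintro ⟨y, hy⟩; exact (congrArg Sigma.fst hy).symm
  rw [this, card_map, card_univ, Fintype.card_fin]

theorem mean_two_le_vcount_eq_zero {S : Finset (Σ i, Fin (n i))} {i : ι}
    (hS : ∀ v ∈ S, v.1 = i) : mean (fun t => (ind (2 ≤ vcount S t) : ℚ)) = 0 := by
  have : ∀ t, ind (2 ≤ vcount S t) = 0 := fun t => ind_not (by have := vcount_le_one hS t; omega)
  simp [this, mean]

/-- In the case of equality, `S` consists of two complete partite sets. -/
theorem eq_two_parts_of_mean_eq (hpos : ∀ i, 0 < n i) (M : ℕ) (S : Finset (Σ i, Fin (n i)))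
    (hS : 2 ≤ #S) (hM : ∀ v ∈ S, ∀ w ∈ S, v.1 ≠ w.1 → M ≤ n v.1 + n w.1)
    (h2 : ∀ v ∈ S, 2 ≤ n v.1)
    (heq : mean (fun t => (ind (2 ≤ vcount S t) : ℚ)) * (M - 1) = #S - 1) :
    ∃ i j, i ≠ j ∧ n i + n j = M ∧ ∀ v, v ∈ S ↔ v.1 = i ∨ v.1 = j := by
  obtain ⟨v, hv⟩ : S.Nonempty := card_pos.1 (by omega)
  have hcard : #(S.filter (·.1 = v.1)) + #(S.filter (¬ ·.1 = v.1)) = #S :=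
    card_filter_add_card_filter_not _
  have hp : 0 < #(S.filter (·.1 = v.1)) := card_pos.2 ⟨v, by simp [hv]⟩
  have hsub : S.filter (·.1 = v.1) ⊆ univ.filter (·.1 = v.1) := filter_subset_filter _ (subset_univ _)
  have hle : #(S.filter (·.1 = v.1)) ≤ n v.1 := by
    simpa [card_part] using card_le_card hsub
  have hS2 : (2 : ℚ) ≤ #S := by exact_mod_cast hS
  rw [mean_two_le_vcount hpos S v.1] at heq
  rcases (S.filter (¬ ·.1 = v.1)).eq_empty_or_nonempty with h0 | h0
  · simp only [h0, vcount, sum_empty] at heq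
    simp [ind, mean] at heq
    linarith
  · have e1 := mean_one_le_vcount_bound hpos (M := M) (i := v.1) h0 fun w hw =>
      hM v hv w (mem_filter.1 hw).1 (Ne.symm (mem_filter.1 hw).2)
    have e2 := mean_two_le_vcount_le hpos M _ h0 (fun u hu w hw =>
      hM u (mem_filter.1 hu).1 w (mem_filter.1 hw).1)
    have hO : ∀ w ∈ S.filter (¬ ·.1 = v.1), M ≤ n v.1 + n w.1 := fun w hw =>
      hM v hv w (mem_filter.1 hw).1 (Ne.symm (mem_filter.1 hw).2)
    have hO2 : ∀ w ∈ S.filter (¬ ·.1 = v.1), 2 ≤ n w.1 := fun w hw => h2 w (mem_filter.1 hw).1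
    have hOv : ∀ w ∈ S.filter (¬ ·.1 = v.1), w.1 ≠ v.1 := fun w hw => (mem_filter.1 hw).2
    have hn : (0 : ℚ) < n v.1 := by exact_mod_cast hpos _
    have hn2 : (2 : ℚ) ≤ n v.1 := by exact_mod_cast h2 v hv
    set O := S.filter (¬ ·.1 = v.1) with hOdef
    set A := mean (fun t => (ind (1 ≤ vcount O t) : ℚ)) with hA
    set B := mean (fun t => (ind (2 ≤ vcount O t) : ℚ)) with hB
    set p := #(S.filter (·.1 = v.1)) with hpdef
    have hq : (0 : ℚ) < p / n v.1 := by positivity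
    have hq1 : (p : ℚ) / n v.1 ≤ 1 := by
      rw [div_le_one hn]; exact_mod_cast hle
    have hs' : (#S : ℚ) = p / n v.1 * n v.1 + #O := by
      rw [← hcard]; push_cast; field_simp
    rw [hs'] at heq
    have hA1 : A ≤ 1 := mean_ind_le_one hpos _
    have hA0 : 0 ≤ A := mean_nonneg fun t => by positivity
    have ho : (1 : ℚ) ≤ #O := by exact_mod_cast h0.card_pos
    set q := (p : ℚ) / n v.1 with hqdef
    -- Equality of the convex combination makes each of its two slacks, multiplied by its weight,
    -- vanish. Since `q > 0`, the estimate for `A` is sharp.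
    have f1 : q * (#O + n v.1 - 1 - A * (M - 1)) = 0 := by
      nlinarith [mul_nonneg hq.le (sub_nonneg.2 e1), mul_nonneg (sub_nonneg.2 hq1) (sub_nonneg.2 e2)]
    have f2 : (1 - q) * (#O - 1 - B * (M - 1)) = 0 := by
      nlinarith [mul_nonneg hq.le (sub_nonneg.2 e1), mul_nonneg (sub_nonneg.2 hq1) (sub_nonneg.2 e2)]
    have g1 : A * (M - 1) = #O + n v.1 - 1 := by
      rcases mul_eq_zero.1 f1 with h | h <;> linarith
    -- Both cases of the estimate for `A` are strict away from `M = |O| + n_i`, since `n_i ≥ 2`. At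
    -- this value sharpness means `A = 1`, so `O` contains a whole part, and the sizes leave room
    -- for nothing else.
    have hMeq : M = #O + n v.1 := by
      rcases lt_trichotomy M (#O + n v.1) with h | h | h
      · have : (M : ℚ) < #O + n v.1 := by exact_mod_cast h
        nlinarith
      · exact h
      · obtain ⟨m, rfl⟩ : ∃ m, M = n v.1 + m := ⟨M - n v.1, by omega⟩
        have hm : #O < m := by omega
        have hm' : (#O : ℚ) < m := by exact_mod_cast hm
        have h2 : A ≤ #O / m :=
          (mean_mono (ind_le_vcount O)).trans
            (mean_vcount_le hpos (by omega) fun v hv => by have := hO v hv; omega)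
        rw [le_div_iff₀ (by linarith)] at h2
        push_cast at g1
        nlinarith
    have hM' : (M : ℚ) = #O + n v.1 := by exact_mod_cast hMeq
    have hA' : A = 1 := by
      have : (A - 1) * ((M : ℚ) - 1) = 0 := by rw [sub_mul, g1, hM']; ring
      rcases mul_eq_zero.1 this with h | h <;> linarith
    obtain ⟨j, hj⟩ := exists_full_part O hpos hA'.ge
    have hjO := hO ⟨j, ⟨0, hpos j⟩⟩ (hj _)
    have hj2 := hO2 ⟨j, ⟨0, hpos j⟩⟩ (hj _)
    have hjv := hOv ⟨j, ⟨0, hpos j⟩⟩ (hj _)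
    simp only at hjO hj2 hjv
    have hOeq : univ.filter (·.1 = j) = O := by
      refine eq_of_subset_of_card_le ?_ (by rw [card_part]; omega)
      rintro ⟨i, x⟩ hx
      obtain rfl : i = j := by simpa using hx
      exact hj x
    have hOj : ∀ w ∈ O, w.1 = j := fun w hw => by rw [← hOeq] at hw; simpa using hw
    have hB0 : B = 0 := mean_two_le_vcount_eq_zero hOj
    have hOc : #O = n j := by rw [← hOeq, card_part]
    -- The set `O` is one part, so `B = 0`, while `|O| - 1 > 0`. The second slack is therefore
    -- nonzero and its weight `1 - q` has to vanish: the part of `v` is also full.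
    have hq' : q = 1 := by
      have : (2 : ℚ) ≤ #O := by rw [hOc]; exact_mod_cast hj2
      rcases mul_eq_zero.1 f2 with h | h
      · linarith
      · rw [hB0] at h; linarith
    have hpn : p = n v.1 := by
      have : (p : ℚ) = n v.1 := by rw [hqdef, div_eq_one_iff_eq hn.ne'] at hq'; exact hq'
      exact_mod_cast this
    have hSv : S.filter (·.1 = v.1) = univ.filter (·.1 = v.1) :=
      eq_of_subset_of_card_le hsub (by rw [card_part]; omega)
    refine ⟨v.1, j, hjv.symm, by omega, fun w => ?_⟩
    have k1 : w ∈ S.filter (·.1 = v.1) ↔ w.1 = v.1 := by rw [hSv]; simp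
    have k2 : w ∈ O ↔ w.1 = j := by rw [← hOeq]; simp
    rw [← k1, ← k2, hOdef, mem_filter, mem_filter]
    tauto

end VertexBound

/-! ### Vertices and edges mixed: the bound and its equality case. -/

section EdgeBound

variable {ι : Type} [Fintype ι] [DecidableEq ι] {n : ι → ℕ}

theorem exists_transversal_edge (hpos : ∀ i, 0 < n i) {v w : Σ i, Fin (n i)} (h : v.1 ≠ w.1) :
    ∃ t : ∀ i, Fin (n i), t v.1 = v.2 ∧ t w.1 = w.2 := by
  refine ⟨Function.update (Function.update (fun i => ⟨0, hpos i⟩) v.1 v.2) w.1 w.2, ?_, ?_⟩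
  · rw [Function.update_of_ne h, Function.update_self]
  · rw [Function.update_self]

theorem exists_transversal_three (hpos : ∀ i, 0 < n i) {u v w : Σ i, Fin (n i)} (huv : u.1 ≠ v.1)
    (huw : u.1 ≠ w.1) (hvw : v.1 ≠ w.1) :
    ∃ t : ∀ i, Fin (n i), t u.1 = u.2 ∧ t v.1 = v.2 ∧ t w.1 = w.2 := by
  obtain ⟨t, h1, h2⟩ := exists_transversal_edge hpos huv
  refine ⟨Function.update t w.1 w.2, ?_, ?_, ?_⟩
  · rw [Function.update_of_ne huw, h1]
  · rw [Function.update_of_ne hvw, h2]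
  · rw [Function.update_self]

/-- The structure of a set of edges at which the mixed bound is attained. -/
theorem star_of_ecount_eq (hpos : ∀ i, 0 < n i) {a b : ℕ} (hb : 2 ≤ b) (hba : b ≤ a)
    {R : Finset (Sym2 (Σ i, Fin (n i)))} (hcr : Crossing R)
    (hRne : R.Nonempty) (hRa : #R = a) (hRab : ∀ v w, s(v, w) ∈ R → a * b ≤ n v.1 * n w.1)
    {y : Σ i, Fin (n i)} (hy : b ≤ n y.1)
    (heq : 1 / (b : ℚ) ≤ mean (fun t => (ind (2 ≤ vcount {y} t + ecount R t) : ℚ))) :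
    ∃ j, y.1 ≠ j ∧ n y.1 = b ∧ n j = a ∧ (∀ e, e ∈ R ↔ ∃ w, w.1 = j ∧ e = s(y, w)) ∧
      ∀ t, ecount R t ≤ 1 := by
  have ha0 : (0 : ℚ) < a := by exact_mod_cast (by omega : 0 < a)
  have hb0 : (0 : ℚ) < b := by exact_mod_cast (by omega : 0 < b)
  have hy1 : ∀ t, vcount {y} t ≤ 1 := fun t => vcount_le_one (i := y.1) (by simp) t
  have hmean := mean_ecount_le hpos (m := a * b) (Nat.mul_pos (by omega) (by omega)) hcr hRab
  have hval : (#R : ℚ) / ((a * b : ℕ) : ℚ) = 1 / b := by rw [hRa]; push_cast; field_simp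
  rw [hval] at hmean
  -- The indicator is at most `ecount R`, whose mean is at most `|R| / (a b) = 1 / b`. The
  -- hypothesis makes the means equal, so every transversal spanning an edge of `R` contains `y` and
  -- spans only that edge of `R`.
  have hpt : ∀ t, (ind (2 ≤ vcount {y} t + ecount R t) : ℚ) = ecount R t := by
    refine eq_of_mean_le hpos (fun t => ?_) (hmean.trans heq)
    by_cases h : 2 ≤ vcount {y} t + ecount R t
    · rw [ind_of h]
      have := hy1 t
      exact_mod_cast (by omega : 1 ≤ ecount R t)
    · rw [ind_not h]; positivity
  have hpt' : ∀ t, ind (2 ≤ vcount {y} t + ecount R t) = ecount R t := fun t => by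
    exact_mod_cast hpt t
  have hle : ∀ t, ecount R t ≤ 1 := fun t => by rw [← hpt' t]; exact ind_le_one _
  have hvy : ∀ t, 1 ≤ ecount R t → t y.1 = y.2 := by
    intro t ht
    have h1 : ind (2 ≤ vcount {y} t + ecount R t) = 1 := by rw [hpt' t]; have := hle t; omega
    have h2 := ind_eq_one.1 h1
    have h3 := hle t
    obtain ⟨v, hv, hvt⟩ := vcount_pos.1 (by omega : 1 ≤ vcount {y} t)
    rw [mem_singleton] at hv
    rwa [hv] at hvt
  -- every edge of `R` contains `y`
  have hmem : ∀ e ∈ R, y ∈ e := by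
    intro e he
    induction e with | _ v w =>
    by_contra hyn
    simp only [Sym2.mem_iff, not_or] at hyn
    obtain ⟨t, h1, h2⟩ := exists_transversal_edge hpos (hcr v w he)
    have hpos' : ∀ t : ∀ i, Fin (n i), t v.1 = v.2 → t w.1 = w.2 → t y.1 = y.2 := fun t h1 h2 =>
      hvy t (ecount_pos.2 ⟨_, he, by simp [h1, h2]⟩)
    -- As the part of `y` has another vertex, a transversal spanning an edge that avoids `y` can be
    -- moved off `y` while still spanning the edge.
    obtain ⟨x, hx⟩ : ∃ x : Fin (n y.1), x ≠ y.2 := by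
      have : Nontrivial (Fin (n y.1)) := Fin.nontrivial_iff_two_le.2 (by omega)
      exact exists_ne _
    have hyv : y.1 ≠ v.1 := by
      intro h
      have := hpos' t h1 h2
      apply hyn.1
      obtain ⟨i, z⟩ := y
      obtain ⟨j, z'⟩ := v
      obtain rfl : i = j := h
      simp only at h1 this
      rw [← this, ← h1]
    have hyw : y.1 ≠ w.1 := by
      intro h
      have := hpos' t h1 h2
      apply hyn.2
      obtain ⟨i, z⟩ := y
      obtain ⟨j, z'⟩ := w
      obtain rfl : i = j := h
      simp only at h2 this
      rw [← this, ← h2]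
    have := hpos' (Function.update t y.1 x) (by rw [Function.update_of_ne hyv.symm, h1])
      (by rw [Function.update_of_ne hyw.symm, h2])
    rw [Function.update_self] at this
    exact hx this
  obtain ⟨e0, he0⟩ := hRne
  obtain ⟨w0, rfl⟩ := Sym2.mem_iff_exists.1 (hmem e0 he0)
  have hyw0 := hcr _ _ he0
  have hall : ∀ e ∈ R, ∃ w, w.1 = w0.1 ∧ e = s(y, w) := by
    intro e he
    obtain ⟨w, rfl⟩ := Sym2.mem_iff_exists.1 (hmem e he)
    refine ⟨w, ?_, rfl⟩
    by_contra hne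
    -- Two edges at `y` ending in different parts lie on a common transversal, which would then span
    -- two edges of `R`.
    obtain ⟨t, h1, h2, h3⟩ := exists_transversal_three hpos (hcr _ _ he) hyw0 hne
    have := two_le_ecount (t := t) he he0 (by
      intro h
      rw [Sym2.congr_right] at h
      exact hne (by rw [h])) (by simp [h1, h2]) (by simp [h1, h3])
    have := hle t
    omega
  have hsub : R ⊆ (univ.filter fun w : Σ i, Fin (n i) => w.1 = w0.1).image (fun w => s(y, w)) := by
    intro e he
    obtain ⟨w, hw, rfl⟩ := hall e he
    exact mem_image.2 ⟨w, by simp [hw], rfl⟩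
  have hcard : #((univ.filter fun w : Σ i, Fin (n i) => w.1 = w0.1).image (fun w => s(y, w))) =
      n w0.1 := by
    rw [card_image_of_injective _ fun w w' h => Sym2.congr_right.1 h, card_part]
  have han : a ≤ n w0.1 := by rw [← hRa, ← hcard]; exact card_le_card hsub
  -- the probability of the edge `s(y, w0)` is `1 / (a * b)`
  have hsz : n y.1 * n w0.1 ≤ a * b := by
    by_contra! hlt
    have h1 : mean (fun t => (ecount R t : ℚ)) < #R • (1 / ((a : ℚ) * b)) := by
      rw [mean_ecount, ← sum_const]
      refine sum_lt_sum (fun e he => ?_) ⟨_, he0, ?_⟩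
      · induction e with | _ v w =>
        rw [mean_ind_edge hpos (hcr v w he)]
        exact one_div_le_one_div_of_le (by positivity) (by exact_mod_cast hRab v w he)
      · rw [mean_ind_edge hpos hyw0]
        exact one_div_lt_one_div_of_lt (by positivity) (by exact_mod_cast hlt)
    have h2 : mean (fun t => (ecount R t : ℚ)) =
        mean (fun t => (ind (2 ≤ vcount {y} t + ecount R t) : ℚ)) := by
      congr 1; ext t; exact (hpt t).symm
    rw [h2, hRa, nsmul_eq_mul] at h1
    have h3 : (a : ℚ) * (1 / (a * b)) = 1 / b := by field_simp
    linarith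
  have hnj : n w0.1 = a := by nlinarith
  have hny : n y.1 = b := by nlinarith
  refine ⟨w0.1, hyw0, hny, hnj, fun e => ⟨hall e, ?_⟩, hle⟩
  rintro ⟨w, hw, rfl⟩
  rw [eq_of_subset_of_card_le hsub (by omega)]
  exact mem_image.2 ⟨w, by simp [hw], rfl⟩

/-- The bound for a mixture of vertices and edges. -/
theorem mixed_bound (hpos : ∀ i, 0 < n i) {a b : ℕ} (hb : 2 ≤ b) (hba : b ≤ a) {l : ι}
    (hl : n l = b) {S : Finset (Σ i, Fin (n i))} {R : Finset (Sym2 (Σ i, Fin (n i)))}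
    (hS : ∀ v ∈ S, v.1 ≠ l → a ≤ n v.1) (hR : ∀ e ∈ R, ∀ v ∈ e, v.1 ≠ l → a ≤ n v.1)
    (hcr : Crossing R) (hSne : S.Nonempty) (hRne : R.Nonempty) :
    b * (a + b - 1) * mean (fun t => (ind (2 ≤ vcount S t + ecount R t) : ℚ)) ≤
        b * #S + (#R - 1) ∧
      (b * (a + b - 1) * mean (fun t => (ind (2 ≤ vcount S t + ecount R t) : ℚ)) =
        b * #S + (#R - 1) → ∃ y j, y.1 ≠ j ∧ n y.1 = b ∧ n j = a ∧ S = {y} ∧ #R = a ∧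
          (∀ e, e ∈ R ↔ ∃ w, w.1 = j ∧ e = s(y, w)) ∧ ∀ t, ecount R t ≤ 1) := by
  have ha2 : (2 : ℚ) ≤ a := by exact_mod_cast (by omega : 2 ≤ a)
  have hb2 : (2 : ℚ) ≤ b := by exact_mod_cast hb
  have hbaq : (b : ℚ) ≤ a := by exact_mod_cast hba
  have hs1 : (1 : ℚ) ≤ #S := by exact_mod_cast hSne.card_pos
  have hbS : ∀ v ∈ S, b ≤ n v.1 := fun v hv => by
    by_cases h : v.1 = l
    · rw [h, hl]
    · exact hba.trans (hS v hv h)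
  have hbR : ∀ e ∈ R, ∀ v ∈ e, b ≤ n v.1 := fun e he v hv => by
    by_cases h : v.1 = l
    · rw [h, hl]
    · exact hba.trans (hR e he v hv h)
  have hab : ∀ v w, s(v, w) ∈ R → a * b ≤ n v.1 * n w.1 := by
    intro v w he
    by_cases h : v.1 = l
    · rw [mul_comm]
      refine Nat.mul_le_mul (hbR _ he v (by simp)) (hR _ he w (by simp) ?_)
      rw [← h]; exact (hcr _ _ he).symm
    · exact Nat.mul_le_mul (hR _ he v (by simp) h) (hbR _ he w (by simp))
  have hRmean := mean_ecount_le hpos (m := a * b) (Nat.mul_pos (by omega) (by omega)) hcr hab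
  have hM : ∀ v ∈ S, ∀ w ∈ S, v.1 ≠ w.1 → a + b ≤ n v.1 + n w.1 := by
    intro v hv w hw hvw
    by_cases h : v.1 = l
    · have := hS w hw (by rw [← h]; exact hvw.symm)
      have := hbS v hv
      omega
    · have := hS v hv h
      have := hbS w hw
      omega
  have hL1 := mean_two_le_vcount_le hpos (a + b) S hSne hM
  push_cast at hL1 hRmean
  set P := mean (fun t => (ind (2 ≤ vcount S t + ecount R t) : ℚ)) with hP
  -- the bound for few edges
  have hsmall : P ≤ mean (fun t => (ind (2 ≤ vcount S t) : ℚ)) +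
      mean (fun t => (ecount R t : ℚ)) := by
    rw [← mean_add]
    refine mean_mono fun t => ?_
    by_cases h : 2 ≤ vcount S t
    · rw [ind_of h]
      have : (ind (2 ≤ vcount S t + ecount R t) : ℚ) ≤ 1 := by exact_mod_cast ind_le_one _
      have : (0 : ℚ) ≤ ecount R t := by positivity
      push_cast
      linarith
    · by_cases h' : 2 ≤ vcount S t + ecount R t
      · rw [ind_of h', ind_not h]
        have : (1 : ℚ) ≤ ecount R t := by exact_mod_cast (by omega : 1 ≤ ecount R t)
        push_cast
        linarith
      · rw [ind_not h', ind_not h]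
        push_cast
        positivity
  -- the bound for many edges
  have hlarge : (a + b) * P ≤ #S + #R / b := by
    have h1 : ∀ v ∈ S.filter (·.1 = l), v.1 = l := fun v hv => (mem_filter.1 hv).2
    have hc : (#S : ℚ) = #(S.filter (·.1 = l)) + #(S.filter (¬ ·.1 = l)) := by
      rw [← card_filter_add_card_filter_not (s := S) (·.1 = l)]; push_cast; rfl
    have m1 := mean_vcount_le hpos (S := S.filter (·.1 = l)) (m := b) (by omega)
      fun v hv => hbS v (mem_filter.1 hv).1
    have m2 := mean_vcount_le hpos (S := S.filter (¬ ·.1 = l)) (m := a) (by omega)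
      fun v hv => hS v (mem_filter.1 hv).1 (mem_filter.1 hv).2
    rw [le_div_iff₀ (by linarith)] at m1 m2
    have m3 : a * mean (fun t => (ecount R t : ℚ)) ≤ #R / b := by
      calc a * mean (fun t => (ecount R t : ℚ)) ≤ a * (#R / (a * b)) := by gcongr
        _ = #R / b := by field_simp
    calc (a + b) * P = mean (fun t => ((a : ℚ) + b) * ind (2 ≤ vcount S t + ecount R t)) := by
          rw [mean_const_mul]
      _ ≤ mean (fun t => (b : ℚ) * vcount (S.filter (·.1 = l)) t +
            (a * vcount (S.filter (¬ ·.1 = l)) t + a * ecount R t)) := by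
          -- Weights `b` for the vertices in part `l` and `a` for everything else. When at least two
          -- objects are hit their total weight is at least `a + b`, because a transversal picks at
          -- most one vertex in `l` and `b ≤ a`.
          refine mean_mono fun t => ?_
          have hv := vcount_le_one h1 t
          rw [← vcount_filter_add S l t]
          set x := vcount (S.filter (·.1 = l)) t
          set z := vcount (S.filter (¬ ·.1 = l)) t
          by_cases h : 2 ≤ x + z + ecount R t
          · rw [ind_of h]
            interval_cases x
            · have : (2 : ℚ) ≤ z + ecount R t := by
                exact_mod_cast (by omega : 2 ≤ z + ecount R t)
              push_cast
              nlinarith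
            · have : (1 : ℚ) ≤ z + ecount R t := by
                exact_mod_cast (by omega : 1 ≤ z + ecount R t)
              push_cast
              nlinarith
          · rw [ind_not h]
            push_cast
            rw [mul_zero]
            positivity
      _ ≤ #S + #R / b := by
          rw [mean_add, mean_add, mean_const_mul, mean_const_mul, mean_const_mul, hc]
          linarith
  have hlarge' : b * (a + b) * P ≤ b * #S + #R := by
    have := mul_le_mul_of_nonneg_left hlarge (by linarith : (0 : ℚ) ≤ b)
    rw [mul_add, mul_div_cancel₀ _ (by linarith)] at this
    linarith
  have hsmall' : a * b * (a + b - 1) * P ≤ a * b * (#S - 1) + #R * (a + b - 1) := by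
    rw [le_div_iff₀ (by positivity)] at hRmean
    have hk : (0 : ℚ) ≤ a + b - 1 := by linarith
    have := mul_le_mul_of_nonneg_left hsmall (by positivity : (0 : ℚ) ≤ a * b * (a + b - 1))
    have h1 := mul_le_mul_of_nonneg_left hL1 (by positivity : (0 : ℚ) ≤ a * b)
    have h2 := mul_le_mul_of_nonneg_left hRmean hk
    nlinarith
  -- both bounds in a form ready for comparison
  have hA : a * (b * (a + b - 1) * P) + (b - 1) * (a - #R) ≤ a * (b * #S + (#R - 1)) := by
    nlinarith
  have hB : (a + b) * (b * (a + b - 1) * P) + (b * #S + #R - (a + b)) ≤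
      (a + b) * (b * #S + (#R - 1)) := by
    have := mul_le_mul_of_nonneg_left hlarge' (by linarith : (0 : ℚ) ≤ a + b - 1)
    nlinarith
  set Q := b * (a + b - 1) * P with hQ
  constructor
  · rcases le_total #R a with h | h
    · have h' : (#R : ℚ) ≤ a := by exact_mod_cast h
      have : 0 ≤ (b - 1 : ℚ) * (a - #R) := mul_nonneg (by linarith) (by linarith)
      exact le_of_mul_le_mul_left (by linarith) (by linarith : (0 : ℚ) < a)
    · have h' : (a : ℚ) ≤ #R := by exact_mod_cast h
      have : (b : ℚ) * 1 ≤ b * #S := by gcongr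
      exact le_of_mul_le_mul_left (by linarith) (by linarith : (0 : ℚ) < a + b)
  · intro heq
    -- In the case of equality `hA` gives `|R| ≥ a`, as `b ≥ 2`, and `hB` gives `b |S| + |R| ≤ a +
    -- b`. Together they force `|R| = a` and `|S| = 1`.
    rw [heq] at hA hB
    have hRa : #R = a := by
      apply le_antisymm
      · have : (b : ℚ) * 1 ≤ b * #S := by gcongr
        have : (#R : ℚ) ≤ a := by linarith
        exact_mod_cast this
      · have : (a : ℚ) ≤ #R := by nlinarith
        exact_mod_cast this
    have hRa' : (#R : ℚ) = a := by exact_mod_cast hRa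
    have hS1 : #S = 1 := by
      apply le_antisymm _ hSne.card_pos
      have : (#S : ℚ) ≤ 1 := by nlinarith
      exact_mod_cast this
    obtain ⟨y, rfl⟩ := card_eq_one.1 hS1
    obtain ⟨j, h1, h2, h3, h4, h5⟩ := star_of_ecount_eq hpos hb hba hcr hRne hRa hab
      (y := y) (hbS y (by simp)) (by
        rw [← hP, div_le_iff₀ (by linarith)]
        rw [hRa', hS1] at heq
        have : (b * P - 1) * (a + b - 1 : ℚ) = 0 := by
          push_cast at heq
          rw [hQ] at heq
          linarith
        rcases mul_eq_zero.1 this with h | h <;> linarith)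
    exact ⟨y, j, h1, h2, h3, rfl, hRa, h4, h5⟩

end EdgeBound

/-! ### The bound for one color class by conditioning on the smallest part. -/

section ClassBound

variable {ι : Type} [Fintype ι] [DecidableEq ι] {n : ι → ℕ}

/-- The other ends of the edges of `F` at the vertex `u` of the partite set `κ`. -/
def starAt (F : Finset (Sym2 (Σ i, Fin (n i)))) (κ : ι) (u : Fin (n κ)) :
    Finset (Σ i, Fin (n i)) :=
  univ.filter fun v => s(⟨κ, u⟩, v) ∈ F

open scoped Classical in
/-- The edges of `F` that avoid the partite set `κ`. -/
noncomputable def away (F : Finset (Sym2 (Σ i, Fin (n i)))) (κ : ι) :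
    Finset (Sym2 (Σ i, Fin (n i))) :=
  F.filter fun e => ∀ v ∈ e, v.1 ≠ κ

theorem mem_starAt {F : Finset (Sym2 (Σ i, Fin (n i)))} {κ : ι} {u : Fin (n κ)}
    {v : Σ i, Fin (n i)} : v ∈ starAt F κ u ↔ s(⟨κ, u⟩, v) ∈ F := by simp [starAt]

theorem mem_away {F : Finset (Sym2 (Σ i, Fin (n i)))} {κ : ι} {e : Sym2 (Σ i, Fin (n i))} :
    e ∈ away F κ ↔ e ∈ F ∧ ∀ v ∈ e, v.1 ≠ κ := mem_filter

theorem ne_of_mem_starAt {F : Finset (Sym2 (Σ i, Fin (n i)))} (hcr : Crossing F) {κ : ι}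
    {u : Fin (n κ)} {v : Σ i, Fin (n i)} (hv : v ∈ starAt F κ u) : v.1 ≠ κ :=
  (hcr _ _ (mem_starAt.1 hv)).symm

theorem sum_eq_sum_starAt {F : Finset (Sym2 (Σ i, Fin (n i)))} (hcr : Crossing F) (κ : ι)
    (g : Sym2 (Σ i, Fin (n i)) → ℕ) :
    ∑ e ∈ F, g e = ∑ u, ∑ v ∈ starAt F κ u, g s(⟨κ, u⟩, v) + ∑ e ∈ away F κ, g e := by
  classical
  rw [add_comm, ← sum_filter_add_sum_filter_not F (fun e => ∀ v ∈ e, v.1 ≠ κ)]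
  congr 1
  rw [sum_sigma']
  symm
  refine sum_bij (fun p _ => s(⟨κ, p.1⟩, p.2)) ?_ ?_ ?_ ?_
  · rintro ⟨u, v⟩ h
    rw [mem_sigma] at h
    rw [mem_filter]
    refine ⟨mem_starAt.1 h.2, fun hn => hn ⟨κ, u⟩ (by simp) rfl⟩
  · rintro ⟨u, v⟩ h ⟨u', v'⟩ h' heq
    have h1 := ne_of_mem_starAt hcr (mem_sigma.1 h).2
    have h2 := ne_of_mem_starAt hcr (mem_sigma.1 h').2
    simp only at h1 h2 heq
    rw [Sym2.eq_iff] at heq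
    rcases heq with ⟨h3, h4⟩ | ⟨h3, h4⟩
    · simp only [Sigma.mk.injEq, heq_eq_eq, true_and] at h3
      rw [h3, h4]
    · exact absurd (by rw [← h3]) h2
  · intro e he
    rw [mem_filter] at he
    obtain ⟨he, hne⟩ := he
    push Not at hne
    obtain ⟨⟨i, u⟩, hu, hi⟩ := hne
    obtain rfl : i = κ := hi
    obtain ⟨v, rfl⟩ := Sym2.mem_iff_exists.1 hu
    exact ⟨⟨u, v⟩, by simp [mem_starAt, he], rfl⟩
  · intros; rfl

theorem card_eq_sum_starAt {F : Finset (Sym2 (Σ i, Fin (n i)))} (hcr : Crossing F) (κ : ι) :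
    #F = ∑ u, #(starAt F κ u) + #(away F κ) := by
  simpa using sum_eq_sum_starAt hcr κ (fun _ => 1)

theorem ecount_eq_starAt {F : Finset (Sym2 (Σ i, Fin (n i)))} (hcr : Crossing F) (κ : ι)
    (t : ∀ i, Fin (n i)) :
    ecount F t = vcount (starAt F κ (t κ)) t + ecount (away F κ) t := by
  rw [ecount, sum_eq_sum_starAt hcr κ]
  congr 1
  rw [sum_eq_single (t κ)]
  · refine sum_congr rfl fun v _ => ?_
    congr 1
    simp
  · intro u _ hu
    refine sum_eq_zero fun v _ => ind_not fun h => hu ?_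
    exact (h ⟨κ, u⟩ (by simp)).symm
  · simp

/-- Conditioning on the vertex of a transversal in the partite set `κ`. -/
theorem mean_two_le_ecount (hpos : ∀ i, 0 < n i) {F : Finset (Sym2 (Σ i, Fin (n i)))}
    (hcr : Crossing F) (κ : ι) :
    n κ * mean (fun t => (ind (2 ≤ ecount F t) : ℚ)) =
      ∑ u, mean (fun t => (ind (2 ≤ vcount (starAt F κ u) t + ecount (away F κ) t) : ℚ)) := by
  have h1 : ∀ u, mean (fun t => (ind (2 ≤ vcount (starAt F κ u) t + ecount (away F κ) t) : ℚ)) =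
      n κ * mean (fun t => (ind (t κ = u) : ℚ) *
        ind (2 ≤ vcount (starAt F κ u) t + ecount (away F κ) t)) := by
    intro u
    have : (n κ : ℚ) ≠ 0 := by exact_mod_cast (hpos κ).ne'
    rw [mean_ind_mul hpos κ u, mul_div_cancel₀ _ this]
    intro t y
    rw [vcount_update (fun v hv => ne_of_mem_starAt hcr hv),
      ecount_update (fun e he => (mem_away.1 he).2)]
  simp only [h1]
  rw [← mul_sum, ← mean_sum]
  congr 2
  ext t
  rw [sum_eq_single (t κ), ind_of rfl, ecount_eq_starAt hcr κ]
  · simp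
  · intro u _ hu
    rw [ind_not (Ne.symm hu)]; simp
  · simp

/-- The set `F` consists of all edges between a vertex in a partite set of size `c` and two partite
sets of total size `M`. -/
def IsFullStar (F : Finset (Sym2 (Σ i, Fin (n i)))) (c M : ℕ) : Prop :=
  ∃ (y : Σ i, Fin (n i)) (i j : ι), i ≠ j ∧ y.1 ≠ i ∧ y.1 ≠ j ∧ n y.1 = c ∧ n i + n j = M ∧
    ∀ e, e ∈ F ↔ ∃ w, (w.1 = i ∨ w.1 = j) ∧ e = s(y, w)

theorem crossing_away {F : Finset (Sym2 (Σ i, Fin (n i)))} (hcr : Crossing F) (κ : ι) :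
    Crossing (away F κ) := fun v w h => hcr v w (mem_away.1 h).1

theorem mem_iff_starAt {F : Finset (Sym2 (Σ i, Fin (n i)))} {κ : ι} {e : Sym2 (Σ i, Fin (n i))} :
    e ∈ F ↔ (∃ u, ∃ v ∈ starAt F κ u, e = s(⟨κ, u⟩, v)) ∨ e ∈ away F κ := by
  constructor
  · intro he
    by_cases h : ∀ v ∈ e, v.1 ≠ κ
    · exact Or.inr (mem_away.2 ⟨he, h⟩)
    · push Not at h
      obtain ⟨⟨i, u⟩, hu, hi⟩ := h
      obtain rfl : i = κ := hi
      obtain ⟨v, rfl⟩ := Sym2.mem_iff_exists.1 hu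
      exact Or.inl ⟨u, v, mem_starAt.2 he, rfl⟩
  · rintro (⟨u, v, hv, rfl⟩ | h)
    · exact mem_starAt.1 hv
    · exact (mem_away.1 h).1

/-- The bound for a set of edges all of which meet the partite set `κ`. -/
theorem class_bound_of_away_empty (hpos : ∀ i, 0 < n i) {κ : ι} {M : ℕ}
    {F : Finset (Sym2 (Σ i, Fin (n i)))} (hcr : Crossing F) (hF : F.Nonempty)
    (hM : ∀ u, ∀ v ∈ starAt F κ u, ∀ w ∈ starAt F κ u, v.1 ≠ w.1 → M ≤ n v.1 + n w.1)
    (h2 : ∀ u, ∀ v ∈ starAt F κ u, 2 ≤ n v.1) (haw : away F κ = ∅) :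
    n κ * (M - 1) * mean (fun t => (ind (2 ≤ ecount F t) : ℚ)) ≤ #F - 1 ∧
      (2 ≤ #F → n κ * (M - 1) * mean (fun t => (ind (2 ≤ ecount F t) : ℚ)) = #F - 1 →
        IsFullStar F (n κ) M) := by
  have hcard := card_eq_sum_starAt hcr κ
  have hmean := mean_two_le_ecount hpos hcr κ
  simp only [haw, card_empty, add_zero, ecount, sum_empty] at hcard hmean
  change n κ * mean (fun t => (ind (2 ≤ ecount F t) : ℚ)) = _ at hmean
  obtain ⟨u0, hu0⟩ : ∃ u, (starAt F κ u).Nonempty := by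
    by_contra! h
    have : #F = 0 := by rw [hcard]; simp [h]
    exact hF.card_pos.ne' this
  set P := fun u => mean (fun t => (ind (2 ≤ vcount (starAt F κ u) t) : ℚ)) with hP
  have hne : ∀ u, (starAt F κ u).Nonempty → P u * (M - 1) ≤ #(starAt F κ u) - 1 := fun u hu =>
    mean_two_le_vcount_le hpos M _ hu (hM u)
  -- Each nonempty star could save 1, but only the star at `u0` is charged for it. The sum then is
  -- exactly `|F| - 1`, and equality forces all other stars to be empty.
  have hle : ∀ u ∈ univ, P u * (M - 1) ≤ #(starAt F κ u) - (ind (u = u0) : ℚ) := by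
    intro u _
    by_cases hu : (starAt F κ u).Nonempty
    · have : (ind (u = u0) : ℚ) ≤ 1 := by exact_mod_cast ind_le_one _
      linarith [hne u hu]
    · have h0 : u ≠ u0 := by rintro rfl; exact hu hu0
      rw [not_nonempty_iff_eq_empty] at hu
      simp [hP, hu, vcount, ind, mean, h0]
  have hr : ∑ u, ((#(starAt F κ u) : ℚ) - (ind (u = u0) : ℚ)) = #F - 1 := by
    rw [sum_sub_distrib, hcard]
    simp [ind]
  have hl : n κ * (M - 1) * mean (fun t => (ind (2 ≤ ecount F t) : ℚ)) =
      ∑ u, P u * (M - 1) := by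
    rw [← sum_mul, ← hmean]; ring
  rw [hl, ← hr]
  refine ⟨sum_le_sum hle, fun hF2 heq => ?_⟩
  have hpt := (sum_eq_sum_iff_of_le hle).1 heq
  have hemp : ∀ u, u ≠ u0 → starAt F κ u = ∅ := by
    intro u hu
    by_contra hn
    have h1 := hne u (nonempty_iff_ne_empty.2 hn)
    have h2 := hpt u (mem_univ u)
    rw [ind_not hu] at h2
    push_cast at h2
    linarith
  have hF0 : #F = #(starAt F κ u0) := by
    rw [hcard]
    exact sum_eq_single u0 (fun u _ hu => by rw [hemp u hu, card_empty]) (by simp)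
  have h0 := hpt u0 (mem_univ u0)
  rw [ind_of rfl, Nat.cast_one] at h0
  obtain ⟨i, j, hij, hsum, hS⟩ := eq_two_parts_of_mean_eq hpos M _ (hF0 ▸ hF2) (hM u0) (h2 u0) h0
  refine ⟨⟨κ, u0⟩, i, j, hij, ?_, ?_, rfl, hsum, fun e => ?_⟩
  · exact (ne_of_mem_starAt hcr ((hS ⟨i, ⟨0, hpos i⟩⟩).2 (Or.inl rfl))).symm
  · exact (ne_of_mem_starAt hcr ((hS ⟨j, ⟨0, hpos j⟩⟩).2 (Or.inr rfl))).symm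
  · rw [mem_iff_starAt (κ := κ), haw]
    constructor
    · rintro (⟨u, v, hv, rfl⟩ | h)
      · have : u = u0 := by
          by_contra hu
          rw [hemp u hu] at hv
          simp at hv
        subst this
        exact ⟨v, (hS v).1 hv, rfl⟩
      · simp at h
    · rintro ⟨w, hw, rfl⟩
      exact Or.inl ⟨u0, w, (hS w).2 hw, rfl⟩

/-- A transversal spans two edges of `F` with probability at most `(|F| - 1) / (c (a + b - 1))`,
where `c`, `b`, `a` are lower bounds for the smallest sizes of the partite sets. -/
theorem class_bound (hpos : ∀ i, 0 < n i) (I : Finset ι) :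
    ∀ (κ l : ι) (a : ℕ), κ ∈ I → l ∈ I → κ ≠ l → n κ ≤ n l → n l ≤ a → 2 ≤ n l →
    (∀ i ∈ I, i ≠ κ → i ≠ l → a ≤ n i) →
    ∀ F : Finset (Sym2 (Σ i, Fin (n i))), F.Nonempty → Crossing F →
    (∀ e ∈ F, ∀ v ∈ e, v.1 ∈ I) →
    n κ * (a + n l - 1) * mean (fun t => (ind (2 ≤ ecount F t) : ℚ)) ≤ #F - 1 ∧
      (2 ≤ #F → n κ * (a + n l - 1) * mean (fun t => (ind (2 ≤ ecount F t) : ℚ)) = #F - 1 →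
        IsFullStar F (n κ) (a + n l)) := by
  induction hI : #I using Nat.strong_induction_on generalizing I with | _ m ih =>
  intro κ l a hκ hl hκl hcb hba hb2 hIa F hF hcr hFI
  have hstar : ∀ u, ∀ v ∈ starAt F κ u, v.1 ≠ l → a ≤ n v.1 := fun u v hv hvl =>
    hIa v.1 (hFI _ (mem_starAt.1 hv) v (by simp)) (ne_of_mem_starAt hcr hv) hvl
  have hstarb : ∀ u, ∀ v ∈ starAt F κ u, n l ≤ n v.1 := fun u v hv => by
    by_cases h : v.1 = l
    · rw [h]
    · exact hba.trans (hstar u v hv h)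
  rcases (away F κ).eq_empty_or_nonempty with haw | hR
  · have := class_bound_of_away_empty hpos (κ := κ) (M := a + n l) hcr hF ?_ ?_ haw
    · push_cast at this
      exact this
    · intro u v hv w hw hvw
      have h1 := hstarb u v hv
      have h2 := hstarb u w hw
      by_cases h : v.1 = l
      · have := hstar u w hw (by rw [← h]; exact hvw.symm)
        omega
      · have := hstar u v hv h
        omega
    · exact fun u v hv => hb2.trans (hstarb u v hv)
  have hcrR := crossing_away hcr κ
  have hRl : ∀ e ∈ away F κ, ∀ v ∈ e, v.1 ≠ l → a ≤ n v.1 := fun e he v hv hvl =>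
    hIa v.1 (hFI _ (mem_away.1 he).1 v hv) ((mem_away.1 he).2 v hv) hvl
  -- the induction hypothesis for the edges that avoid `κ`
  obtain ⟨μ, hμI, hμκ, hμl, hμmin⟩ : ∃ μ ∈ I, μ ≠ κ ∧ μ ≠ l ∧
      ∀ i ∈ I, i ≠ κ → i ≠ l → n μ ≤ n i := by
    have hne : (I.filter fun i => i ≠ κ ∧ i ≠ l).Nonempty := by
      obtain ⟨e, he⟩ := hR
      induction e with | _ v w =>
      have h1 := (mem_away.1 he).2
      have h2 := hFI _ (mem_away.1 he).1
      by_cases h : v.1 = l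
      · exact ⟨w.1, mem_filter.2 ⟨h2 w (by simp), h1 w (by simp),
          fun hw => hcrR _ _ he (h.trans hw.symm)⟩⟩
      · exact ⟨v.1, mem_filter.2 ⟨h2 v (by simp), h1 v (by simp), h⟩⟩
    obtain ⟨μ, hμ, hmin⟩ := exists_min_image _ n hne
    rw [mem_filter] at hμ
    exact ⟨μ, hμ.1, hμ.2.1, hμ.2.2, fun i hi h1 h2 => hmin i (mem_filter.2 ⟨hi, h1, h2⟩)⟩
  have haμ : a ≤ n μ := hIa μ hμI hμκ hμl
  -- Without `κ` the smallest part is `l` and the next is `μ`. Since no third part need remain, `n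
  -- μ` also serves as the lower bound for the further sizes.
  obtain ⟨ih1, ih2⟩ := ih _ (by rw [← hI]; exact card_erase_lt_of_mem hκ) (I.erase κ) rfl l μ (n μ)
    (by simp [hκl.symm, hl]) (by simp [hμκ, hμI]) hμl.symm (hba.trans haμ) le_rfl
    (hb2.trans (hba.trans haμ))
    (fun i hi h1 h2 => hμmin i (mem_of_mem_erase hi) (ne_of_mem_erase hi) h1)
    (away F κ) hR hcrR (fun e he v hv =>
      mem_erase.2 ⟨(mem_away.1 he).2 v hv, hFI _ (mem_away.1 he).1 v hv⟩)
  have hcq : (1 : ℚ) ≤ n κ := by exact_mod_cast hpos κ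
  have hcbq : (n κ : ℚ) ≤ n l := by exact_mod_cast hcb
  have hbaq : (n l : ℚ) ≤ a := by exact_mod_cast hba
  have hb2q : (2 : ℚ) ≤ n l := by exact_mod_cast hb2
  have haμq : (a : ℚ) ≤ n μ := by exact_mod_cast haμ
  have hRq : (1 : ℚ) ≤ #(away F κ) := by exact_mod_cast hR.card_pos
  have hPR0 : 0 ≤ mean (fun t => (ind (2 ≤ ecount (away F κ) t) : ℚ)) :=
    mean_nonneg fun t => by positivity
  have hcard := card_eq_sum_starAt hcr κ
  have hmean := mean_two_le_ecount hpos hcr κ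
  set P := fun u => mean (fun t => (ind (2 ≤ vcount (starAt F κ u) t + ecount (away F κ) t) : ℚ))
    with hP
  have hempty : ∀ u, starAt F κ u = ∅ →
      P u = mean (fun t => (ind (2 ≤ ecount (away F κ) t) : ℚ)) := by
    intro u hu
    simp [hP, hu, vcount]
  -- At a vertex without edges of `F` the induction hypothesis is enough, since its constant `n l *
  -- (2 * n μ - 1)` is at least `n l * (a + n l - 1)`.
  have hle : ∀ u ∈ univ, n l * (a + n l - 1) * P u ≤
      n l * (#(starAt F κ u) : ℚ) + (#(away F κ) - 1) := by
    intro u _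
    rcases (starAt F κ u).eq_empty_or_nonempty with hu | hu
    · rw [hempty u hu, hu]
      simp only [card_empty, Nat.cast_zero, mul_zero, zero_add]
      refine le_trans ?_ ih1
      refine mul_le_mul_of_nonneg_right ?_ hPR0
      refine mul_le_mul_of_nonneg_left ?_ (by linarith)
      linarith
    · exact (mixed_bound hpos hb2 hba rfl (hstar u) hRl hcrR hu hR).1
  have hl : n l * (n κ * (a + n l - 1) * mean (fun t => (ind (2 ≤ ecount F t) : ℚ))) =
      ∑ u, n l * (a + n l - 1) * P u := by
    rw [← mul_sum, ← hmean]; ring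
  -- The edges avoiding `κ` are counted once for each of the `n κ ≤ n l` vertices of `κ`. What
  -- remains beyond `n l * (|F| - 1)` is a nonnegative slack.
  have hr : ∑ u, (n l * (#(starAt F κ u) : ℚ) + (#(away F κ) - 1)) =
      n l * (#F - 1) - (n l - n κ) * (#(away F κ) - 1) := by
    rw [sum_add_distrib, ← mul_sum, hcard]
    simp only [sum_const, card_univ, Fintype.card_fin, nsmul_eq_mul]
    push_cast
    ring
  have hsum := sum_le_sum hle
  rw [← hl, hr] at hsum
  have hslack : 0 ≤ ((n l : ℚ) - n κ) * (#(away F κ) - 1) :=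
    mul_nonneg (by linarith) (by linarith)
  refine ⟨le_of_mul_le_mul_left (by linarith) (by linarith : (0 : ℚ) < n l), fun hF2 heq => ?_⟩
  rw [heq] at hsum hl
  have hslack0 : ((n l : ℚ) - n κ) * (#(away F κ) - 1) = 0 := by linarith
  have hpt := (sum_eq_sum_iff_of_le hle).1 (by rw [← hl, hr, hslack0, sub_zero])
  by_cases hall : ∀ u, starAt F κ u = ∅
  · have hFR : away F κ = F := by
      ext e
      rw [mem_iff_starAt (κ := κ) (F := F)]
      simp [hall]
    rw [hFR] at ih1 ih2 hPR0
    have hF2q : (2 : ℚ) ≤ #F := by exact_mod_cast hF2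
    set p := mean (fun t => (ind (2 ≤ ecount F t) : ℚ)) with hp
    have hp0 : 0 < p := by
      rcases hPR0.lt_or_eq with h | h
      · exact h
      · rw [← h] at heq; linarith
    -- If `F` avoids `κ`, it satisfies the bound for the smaller index set with a constant at least
    -- as large. Equality with positive probability makes the constants agree, hence `n l = n κ` and
    -- `2 * n μ = a + n l`.
    have hcmp : (n l : ℚ) * (n μ + n μ - 1) ≤ n κ * (a + n l - 1) := by
      refine le_of_mul_le_mul_right ?_ hp0
      linarith
    have g1 : (n l : ℚ) = n κ := by nlinarith
    have g2 : (n μ : ℚ) + n μ = a + n l := by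
      rw [← g1] at hcmp
      have := le_of_mul_le_mul_left hcmp (by linarith)
      linarith
    have := ih2 hF2 (by rw [← heq, g1, g2, g1])
    have g1' : n l = n κ := by exact_mod_cast g1
    have g2' : n μ + n μ = a + n l := by exact_mod_cast g2
    rw [g2', g1'] at this
    rwa [g1']
  · push Not at hall
    obtain ⟨u0, hu0⟩ := hall
    obtain ⟨y, j, hyj, hny, hnj, hSy, hRa, hRmem, hR1⟩ := (mixed_bound hpos hb2 hba rfl (hstar u0)
      hRl hcrR hu0 hR).2 (hpt u0 (mem_univ _))
    have hRa' : (#(away F κ) : ℚ) = a := by exact_mod_cast hRa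
    have hbc : n l = n κ := by
      rw [hRa'] at hslack0
      rcases mul_eq_zero.1 hslack0 with h | h
      · have : (n l : ℚ) = n κ := by linarith
        exact_mod_cast this
      · linarith
    -- An empty star would have probability 0 by `hR1`, yet equality would require `|R| - 1 > 0`.
    -- Every other star is a single vertex, and this vertex is the center of the edges avoiding `κ`,
    -- hence the same for all `u`.
    have hstars : ∀ u, starAt F κ u = {y} := by
      intro u
      rcases (starAt F κ u).eq_empty_or_nonempty with hu | hu
      · exfalso
        have h1 := hpt u (mem_univ _)
        have h2 : ∀ t, ind (2 ≤ ecount (away F κ) t) = 0 := fun t =>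
          ind_not (by have := hR1 t; omega)
        rw [hempty u hu] at h1
        simp only [h2, hu, mean] at h1
        simp at h1
        linarith
      · obtain ⟨y', j', -, -, -, hSy', -, hRmem', -⟩ := (mixed_bound hpos hb2 hba rfl (hstar u)
          hRl hcrR hu hR).2 (hpt u (mem_univ _))
        rw [hSy']
        congr 1
        by_contra hne
        -- A second center would lie on all edges from `y` to part `j`, so it would coincide with
        -- each of the at least two vertices of that part.
        have key : ∀ x : Fin (n j), y' = ⟨j, x⟩ := by
          intro x
          obtain ⟨w, -, hw⟩ := (hRmem' _).1 ((hRmem s(y, ⟨j, x⟩)).2 ⟨⟨j, x⟩, rfl, rfl⟩)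
          rw [Sym2.eq_iff] at hw
          rcases hw with ⟨h, -⟩ | ⟨-, h⟩
          · exact absurd h.symm hne
          · exact h.symm
        have h01 := (key ⟨0, by omega⟩).symm.trans (key ⟨1, by omega⟩)
        simp at h01
    have hyκ : y.1 ≠ κ := ne_of_mem_starAt hcr (u := u0) (by rw [hSy]; simp)
    have hjκ : j ≠ κ := by
      have h1 := (hRmem s(y, ⟨j, ⟨0, hpos j⟩⟩)).2 ⟨_, rfl, rfl⟩
      exact (mem_away.1 h1).2 ⟨j, ⟨0, hpos j⟩⟩ (by simp)
    refine ⟨y, κ, j, hjκ.symm, hyκ, hyj, by omega, by omega, fun e => ?_⟩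
    rw [mem_iff_starAt (κ := κ), hRmem]
    constructor
    · rintro (⟨u, v, hv, rfl⟩ | ⟨w, hw, rfl⟩)
      · rw [hstars u, mem_singleton] at hv
        subst hv
        exact ⟨⟨κ, u⟩, Or.inl rfl, Sym2.eq_swap⟩
      · exact ⟨w, Or.inr hw, rfl⟩
    · rintro ⟨⟨i, x⟩, hw | hw, rfl⟩
      · obtain rfl : i = κ := hw
        exact Or.inl ⟨x, y, by rw [hstars]; simp, Sym2.eq_swap⟩
      · exact Or.inr ⟨_, hw, rfl⟩

end ClassBound

/-! ### The bound for one color class when two parts are single vertices. -/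

section UnitParts

variable {ι : Type} [Fintype ι] [DecidableEq ι] {n : ι → ℕ}

theorem eq_of_unit_part {κ : ι} (hκ : n κ = 1) {v w : Σ i, Fin (n i)} (hv : v.1 = κ)
    (hw : w.1 = κ) : v = w := by
  obtain ⟨i, x⟩ := v
  obtain ⟨j, y⟩ := w
  obtain rfl : i = κ := hv
  obtain rfl : j = i := hw
  have : x = y := by
    apply Fin.ext
    have := x.2
    have := y.2
    omega
  rw [this]

/-- The bound for a set of edges if there are two partite sets of size one, and the conditions for
equality. -/
theorem unit_bound (hpos : ∀ i, 0 < n i) {X Y : Σ i, Fin (n i)}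
    (hX : n X.1 = 1) (hY : n Y.1 = 1) {a : ℕ} (ha : 0 < a)
    (hI : ∀ i, i ≠ X.1 → i ≠ Y.1 → a ≤ n i)
    {F : Finset (Sym2 (Σ i, Fin (n i)))} (hF : F.Nonempty) (hcr : Crossing F) :
    a * mean (fun t => (ind (2 ≤ ecount F t) : ℚ)) ≤ #F - 1 ∧
    (a * mean (fun t => (ind (2 ≤ ecount F t) : ℚ)) = #F - 1 → ∀ e₀ ∈ F, (s(X, Y) ∈ F → e₀ = s(X, Y)) →
      (∀ t, ind (2 ≤ ecount F t) + ind (∀ v ∈ e₀, t v.1 = v.2) = ecount F t) ∧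
        ∀ v w, s(v, w) ∈ F → s(v, w) ≠ e₀ → n v.1 * n w.1 = a) := by
  classical
  have haq : (0 : ℚ) < a := by exact_mod_cast ha
  have hprod : ∀ v w, s(v, w) ∈ F → s(v, w) ≠ s(X, Y) → a ≤ n v.1 * n w.1 := by
    intro v w he hne
    by_cases h1 : v.1 ≠ X.1 ∧ v.1 ≠ Y.1
    · exact (mul_one a).ge.trans (Nat.mul_le_mul (hI _ h1.1 h1.2) (hpos _))
    by_cases h2 : w.1 ≠ X.1 ∧ w.1 ≠ Y.1
    · exact (one_mul a).ge.trans (Nat.mul_le_mul (hpos _) (hI _ h2.1 h2.2))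
    exfalso
    apply hne
    have hvw := hcr v w he
    rw [Sym2.eq_iff]
    by_cases h3 : v.1 = X.1
    · have h4 : w.1 = Y.1 := by
        by_contra h; exact h2 ⟨fun h' => hvw (h3.trans h'.symm), h⟩
      exact Or.inl ⟨eq_of_unit_part hX h3 rfl, eq_of_unit_part hY h4 rfl⟩
    · have h3' : v.1 = Y.1 := by by_contra h; exact h1 ⟨h3, h⟩
      have h4 : w.1 = X.1 := by
        by_contra h; exact h2 ⟨h, fun h' => hvw (h3'.trans h'.symm)⟩
      exact Or.inr ⟨eq_of_unit_part hY h3' rfl, eq_of_unit_part hX h4 rfl⟩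
  -- Every edge other than `XY` meets a part of size at least `a`. If two edges of `F` are spanned,
  -- one of them differs from `e₀`, so a union bound over the remaining `|F| - 1` edges suffices;
  -- `XY` itself must be the discarded edge if it is present.
  have main : ∀ e₀ ∈ F, (s(X, Y) ∈ F → e₀ = s(X, Y)) →
      (∀ t, (ind (2 ≤ ecount F t) : ℚ) ≤ ecount (F.erase e₀) t) ∧
      mean (fun t => (ecount (F.erase e₀) t : ℚ)) ≤ (#F - 1) / a := by
    intro e₀ he₀ hg
    have hadd : ∀ t, ecount F t = ecount (F.erase e₀) t + ind (∀ v ∈ e₀, t v.1 = v.2) := fun t =>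
      (sum_erase_add _ _ he₀).symm
    refine ⟨fun t => ?_, ?_⟩
    · by_cases h : 2 ≤ ecount F t
      · rw [ind_of h]
        have := ind_le_one (∀ v ∈ e₀, t v.1 = v.2)
        have := hadd t
        exact_mod_cast (by omega : 1 ≤ ecount (F.erase e₀) t)
      · rw [ind_not h]; positivity
    · have := mean_ecount_le hpos (F := F.erase e₀) ha
        (fun v w h => hcr v w (mem_of_mem_erase h)) (fun v w h => hprod v w (mem_of_mem_erase h) ?_)
      · rwa [card_erase_of_mem he₀, Nat.cast_sub hF.card_pos, Nat.cast_one] at this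
      · intro h'
        rw [h'] at h
        exact ne_of_mem_erase h (hg (mem_of_mem_erase h)).symm
  constructor
  · obtain ⟨e₀, he₀, hg⟩ : ∃ e₀ ∈ F, (s(X, Y) ∈ F → e₀ = s(X, Y)) := by
      by_cases h : s(X, Y) ∈ F
      · exact ⟨_, h, fun _ => rfl⟩
      · obtain ⟨e, he⟩ := hF
        exact ⟨e, he, fun h' => absurd h' h⟩
    obtain ⟨h1, h2⟩ := main e₀ he₀ hg
    have := (mean_mono h1).trans h2
    rw [le_div_iff₀ haq] at this
    linarith
  · intro heq e₀ he₀ hg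
    obtain ⟨h1, h2⟩ := main e₀ he₀ hg
    have h3 : mean (fun t => (ecount (F.erase e₀) t : ℚ)) ≤
        mean (fun t => (ind (2 ≤ ecount F t) : ℚ)) := by
      rw [← heq, mul_comm, mul_div_cancel_right₀ _ haq.ne'] at h2
      exact h2
    have hpt := eq_of_mean_le hpos h1 h3
    refine ⟨fun t => ?_, fun v w he hne => ?_⟩
    · have h4 : ind (2 ≤ ecount F t) = ecount (F.erase e₀) t := by exact_mod_cast hpt t
      rw [h4]
      exact sum_erase_add _ _ he₀
    · have hne' : ∀ f ∈ F, f ≠ e₀ → f ≠ s(X, Y) := fun f hf hfe h => by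
        subst h
        exact hfe (hg hf).symm
      refine le_antisymm ?_ (hprod v w he (hne' _ he hne))
      -- A single edge whose parts have a larger product would make the union bound strict.
      by_contra! hlt
      have h1 : mean (fun t => (ecount (F.erase e₀) t : ℚ)) < #(F.erase e₀) • (1 / (a : ℚ)) := by
        rw [mean_ecount, ← sum_const]
        refine sum_lt_sum (fun e he => ?_) ⟨_, mem_erase.2 ⟨hne, he⟩, ?_⟩
        · induction e with | _ v w =>
          have he' := mem_of_mem_erase he
          rw [mean_ind_edge hpos (hcr v w he')]
          exact one_div_le_one_div_of_le (by positivity)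
            (by exact_mod_cast hprod v w he' (hne' _ he' (ne_of_mem_erase he)))
        · rw [mean_ind_edge hpos (hcr v w he)]
          exact one_div_lt_one_div_of_lt (by positivity) (by exact_mod_cast hlt)
      rw [card_erase_of_mem he₀, nsmul_eq_mul, Nat.cast_sub hF.card_pos, Nat.cast_one] at h1
      have h4 : mean (fun t => (ind (2 ≤ ecount F t) : ℚ)) = (#F - 1) / a := by
        rw [← heq, mul_comm, mul_div_cancel_right₀ _ haq.ne']
      have h5 := mean_mono (fun t => (hpt t).le)
      rw [h4] at h5
      have h6 : mean (fun t => (ecount (F.erase e₀) t : ℚ)) = (#F - 1) / a := by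
        rw [← h4]; congr 1; ext t; exact (hpt t).symm
      rw [h6] at h1
      have : ((#F : ℚ) - 1) * (1 / a) = (#F - 1) / a := by ring
      linarith

end UnitParts

/-! ### Summation over the colors, and the coloring that gives the lower bound. -/

section Colorings

variable {k : ℕ} {n : Fin k → ℕ}

open scoped Classical in
/-- The edges of color `a`. -/
noncomputable def colorClass (c : (multipartite n).EdgeLabeling ℕ) (a : ℕ) :
    Finset (Sym2 (Σ i, Fin (n i))) :=
  univ.filter fun e => ∃ h : e ∈ (multipartite n).edgeSet, c ⟨e, h⟩ = a

theorem mem_colorClass {c : (multipartite n).EdgeLabeling ℕ} {a : ℕ}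
    {e : Sym2 (Σ i, Fin (n i))} :
    e ∈ colorClass c a ↔ ∃ h : e ∈ (multipartite n).edgeSet, c ⟨e, h⟩ = a := by
  simp [colorClass]

theorem coe_mem_colorClass {c : (multipartite n).EdgeLabeling ℕ} {a : ℕ}
    {e : (multipartite n).edgeSet} : (e : Sym2 _) ∈ colorClass c a ↔ c e = a := by
  rw [mem_colorClass]
  exact ⟨fun ⟨_, h⟩ => h, fun h => ⟨e.2, h⟩⟩

theorem multipartite_adj {v w : Σ i, Fin (n i)} : (multipartite n).Adj v w ↔ v.1 ≠ w.1 := by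
  simp [multipartite, completeMultipartiteGraph]

theorem crossing_colorClass (c : (multipartite n).EdgeLabeling ℕ) (a : ℕ) :
    Crossing (colorClass c a) := by
  intro v w h
  obtain ⟨h, -⟩ := mem_colorClass.1 h
  exact multipartite_adj.1 h

/-- The colors of a coloring. -/
noncomputable def colors (c : (multipartite n).EdgeLabeling ℕ) : Finset ℕ :=
  (Set.finite_range c).toFinset

theorem mem_colors {c : (multipartite n).EdgeLabeling ℕ} {a : ℕ} : a ∈ colors c ↔ ∃ e, c e = a := by
  rw [colors, Set.Finite.mem_toFinset]
  exact Iff.rfl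

theorem card_colors (c : (multipartite n).EdgeLabeling ℕ) : #(colors c) = numColors c :=
  (Set.ncard_eq_toFinset_card _ _).symm

theorem colorClass_nonempty {c : (multipartite n).EdgeLabeling ℕ} {a : ℕ} (ha : a ∈ colors c) :
    (colorClass c a).Nonempty := by
  obtain ⟨e, he⟩ := mem_colors.1 ha
  exact ⟨e, coe_mem_colorClass.2 he⟩

theorem sum_card_colorClass (c : (multipartite n).EdgeLabeling ℕ) :
    ∑ a ∈ colors c, #(colorClass c a) = Nat.card (multipartite n).edgeSet := by
  classical
  rw [Nat.card_eq_fintype_card, ← card_univ,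
    card_eq_sum_card_fiberwise (f := c) (t := colors c) (fun e _ => mem_colors.2 ⟨e, rfl⟩)]
  refine sum_congr rfl fun a _ => ?_
  have : colorClass c a = (univ.filter fun e => c e = a).map (Function.Embedding.subtype _) := by
    ext e
    rw [mem_colorClass]
    simp
  rw [this, card_map]
  congr!

/-- The copy of the complete graph on the vertices of a transversal. -/
def transversalCopy (t : ∀ i, Fin (n i)) : Copy (completeGraph (Fin k)) (multipartite n) where
  toHom := ⟨fun i => ⟨i, t i⟩, fun {i j} h => multipartite_adj.2 (by simpa using h)⟩
  injective' := fun i j h => congrArg Sigma.fst h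

/-- The absence of rainbow copies enters the structural argument only in this form: each transversal
is a `K_k`, so some color occurs on it twice. -/
theorem exists_color_of_not_hasRainbow {c : (multipartite n).EdgeLabeling ℕ}
    (hc : ¬ HasRainbow c (completeGraph (Fin k))) (t : ∀ i, Fin (n i)) :
    ∃ a ∈ colors c, 2 ≤ ecount (colorClass c a) t := by
  by_contra! hcon
  refine hc ⟨transversalCopy t, fun e f hef => ?_⟩
  by_contra hne
  have hmem : ∀ e : (completeGraph (Fin k)).edgeSet,
      ∀ v ∈ ((transversalCopy t).mapEdgeSet e : Sym2 (Σ i, Fin (n i))), t v.1 = v.2 := by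
    rintro ⟨e, he⟩
    induction e with | _ i j =>
    intro v hv
    change v ∈ Sym2.map (fun i => (⟨i, t i⟩ : Σ i, Fin (n i))) s(i, j) at hv
    rw [Sym2.mem_map] at hv
    obtain ⟨i, -, rfl⟩ := hv
    rfl
  have := two_le_ecount (t := t) (F := colorClass c (c ((transversalCopy t).mapEdgeSet e)))
    (coe_mem_colorClass.2 rfl) (coe_mem_colorClass.2 hef.symm)
    (fun h => hne ((transversalCopy t).mapEdgeSet.injective (Subtype.ext h))) (hmem e) (hmem f)
  have := hcon _ (mem_colors.2 ⟨(transversalCopy t).mapEdgeSet e, rfl⟩)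
  omega

/-- If every class satisfies the bound with the constant `N`, then a coloring that loses at most
`N` colors is tight. -/
theorem tight_of_bound (hpos : ∀ i, 0 < n i) {c : (multipartite n).EdgeLabeling ℕ}
    (hc : ¬ HasRainbow c (completeGraph (Fin k))) {N : ℚ} (hN : 0 < N)
    (hbound : ∀ a ∈ colors c,
      N * mean (fun t => (ind (2 ≤ ecount (colorClass c a) t) : ℚ)) ≤ #(colorClass c a) - 1)
    (hnum : (Nat.card (multipartite n).edgeSet : ℚ) ≤ numColors c + N) :
    (∀ a ∈ colors c,
      N * mean (fun t => (ind (2 ≤ ecount (colorClass c a) t) : ℚ)) = #(colorClass c a) - 1) ∧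
    ∀ t, ∀ a ∈ colors c, ∀ b ∈ colors c, 2 ≤ ecount (colorClass c a) t →
      2 ≤ ecount (colorClass c b) t → a = b := by
  have h1 : ∀ t : ∀ i, Fin (n i),
      (1 : ℚ) ≤ ∑ a ∈ colors c, (ind (2 ≤ ecount (colorClass c a) t) : ℚ) := by
    intro t
    have := one_le_sum_ind.2 (exists_color_of_not_hasRainbow hc t)
    exact_mod_cast this
  have h2 : (1 : ℚ) ≤ ∑ a ∈ colors c, mean (fun t => (ind (2 ≤ ecount (colorClass c a) t) : ℚ)) := by
    rw [← mean_sum, ← mean_const hpos 1]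
    exact mean_mono h1
  have h3 : ∑ a ∈ colors c, ((#(colorClass c a) : ℚ) - 1) ≤ N := by
    rw [sum_sub_distrib, ← Nat.cast_sum, sum_card_colorClass, sum_const, card_colors, nsmul_eq_mul]
    linarith
  -- The chain `N ≤ N ∑ P ≤ ∑ (|F| - 1) ≤ N` collapses. Equality of the two sums makes every class
  -- tight, and `∑ P = 1` means that the number of colors occurring twice on a transversal, which is
  -- at least 1, is always exactly 1.
  have h4 := sum_le_sum hbound
  rw [← mul_sum] at h4
  have h5 : N * 1 ≤ N * ∑ a ∈ colors c, mean (fun t => (ind (2 ≤ ecount (colorClass c a) t) : ℚ)) := by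
    gcongr
  have h6 : ∑ a ∈ colors c, mean (fun t => (ind (2 ≤ ecount (colorClass c a) t) : ℚ)) = 1 := by
    apply le_antisymm _ h2
    refine le_of_mul_le_mul_left ?_ hN
    linarith
  refine ⟨(sum_eq_sum_iff_of_le hbound).1 ?_, fun t a ha b hb hat hbt => ?_⟩
  · rw [← mul_sum, h6]
    linarith
  · rw [← mean_sum] at h6
    have h7 := eq_of_mean_le hpos h1 (by rw [h6, mean_const hpos]) t
    have h8 : ∑ a ∈ colors c, ind (2 ≤ ecount (colorClass c a) t) = 1 := by exact_mod_cast h7.symm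
    classical
    rw [sum_ind_eq_card, card_eq_one] at h8
    obtain ⟨d, hd⟩ := h8
    have ha' : a ∈ ({d} : Finset ℕ) := by rw [← hd]; simp [ha, hat]
    have hb' : b ∈ ({d} : Finset ℕ) := by rw [← hd]; simp [hb, hbt]
    rw [mem_singleton] at ha' hb'
    rw [ha', hb']

theorem numColors_le (c : (multipartite n).EdgeLabeling ℕ) :
    numColors c ≤ Nat.card (multipartite n).edgeSet := by
  rw [← card_colors, ← sum_card_colorClass c, card_eq_sum_ones]
  exact sum_le_sum fun a ha => (colorClass_nonempty ha).card_pos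

/-- The `k` vertices are pairwise adjacent, so they lie in different parts, and there are only `k`
parts. -/
theorem copy_meets_part (f : Copy (completeGraph (Fin k)) (multipartite n)) (i : Fin k) :
    ∃ j, (f j).1 = i := by
  have hinj : Function.Injective fun j => (f j).1 := by
    intro j j' h
    by_contra hne
    exact multipartite_adj.1 (f.toHom.map_adj (by simpa using hne : (completeGraph (Fin k)).Adj j j')) h
  exact (Finite.injective_iff_surjective.1 hinj) i

/-- Making the edges between every vertex of the partite set `κ` and two other partite sets
monochromatic destroys all rainbow copies. -/
theorem exists_coloring (hpos : ∀ i, 0 < n i) {κ i j : Fin k} (hi : κ ≠ i) (hj : κ ≠ j)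
    (hij : i ≠ j) : ∃ c : (multipartite n).EdgeLabeling ℕ,
      ¬ HasRainbow c (completeGraph (Fin k)) ∧
      Nat.card (multipartite n).edgeSet ≤ numColors c + n κ * (n i + n j - 1) := by
  classical
  let base : Fin (n κ) → (multipartite n).edgeSet := fun u =>
    ⟨s(⟨κ, u⟩, ⟨i, ⟨0, hpos i⟩⟩), multipartite_adj.2 hi⟩
  -- Each edge receives the color of a representative: the edges from `u` to the two chosen parts
  -- are all represented by `base u`, every other edge by itself.
  let r : (multipartite n).edgeSet → (multipartite n).edgeSet := fun e =>
    if h : ∃ u : Fin (n κ), (e : Sym2 _) ∈ edgesTo (⟨κ, u⟩ : Σ i, Fin (n i)) i j then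
      base h.choose else e
  have hr : ∀ (u : Fin (n κ)) (e : (multipartite n).edgeSet),
      (e : Sym2 _) ∈ edgesTo (⟨κ, u⟩ : Σ i, Fin (n i)) i j → r e = base u := by
    intro u e he
    have hex : ∃ u : Fin (n κ), (e : Sym2 _) ∈ edgesTo (⟨κ, u⟩ : Σ i, Fin (n i)) i j := ⟨u, he⟩
    have : hex.choose = u := by
      obtain ⟨v, hv, hev⟩ := hex.choose_spec
      obtain ⟨w, hw, hew⟩ := he
      have hev := hew.symm.trans hev
      rw [Sym2.eq_iff] at hev
      rcases hev with ⟨h, -⟩ | ⟨h, -⟩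
      · simpa using h.symm
      · rw [← h] at hv
        rcases hv with hv | hv
        · exact absurd hv hi
        · exact absurd hv hj
    simp only [r, dif_pos hex, this]
  let ε := Fintype.equivFin (multipartite n).edgeSet
  let c₀ : (multipartite n).EdgeLabeling ℕ := fun e => (ε (r e) : ℕ)
  have hc₀ : ∀ e, c₀ e = ε (r e) := fun _ => rfl
  refine ⟨c₀, ?_, ?_⟩
  · rintro ⟨f, hf⟩
    obtain ⟨x, hx⟩ := copy_meets_part f κ
    obtain ⟨y, hy⟩ := copy_meets_part f i
    obtain ⟨z, hz⟩ := copy_meets_part f j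
    have hxy : x ≠ y := by rintro rfl; exact hi (hx.symm.trans hy)
    have hxz : x ≠ z := by rintro rfl; exact hj (hx.symm.trans hz)
    have hyz : y ≠ z := by rintro rfl; exact hij (hy.symm.trans hz)
    obtain ⟨u, hu⟩ : ∃ u, f x = ⟨κ, u⟩ := by
      rcases hfx : f x with ⟨p, q⟩
      rw [hfx] at hx
      obtain rfl : p = κ := hx
      exact ⟨q, rfl⟩
    have h1 : r (f.mapEdgeSet ⟨s(x, y), by simpa using hxy⟩) = base u :=
      hr u _ ⟨f y, Or.inl hy, by rw [← hu]; rfl⟩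
    have h2 : r (f.mapEdgeSet ⟨s(x, z), by simpa using hxz⟩) = base u :=
      hr u _ ⟨f z, Or.inr hz, by rw [← hu]; rfl⟩
    have := hf (a₁ := ⟨s(x, y), by simpa using hxy⟩) (a₂ := ⟨s(x, z), by simpa using hxz⟩)
      (by simp only [hc₀, h1, h2])
    rw [Subtype.mk.injEq, Sym2.congr_right] at this
    exact hyz this
  -- The erased vertex is the end of `base u`, which keeps its own color. So each `u` costs `n i + n
  -- j - 1` colors, and `r` fixes every edge outside `D`.
  · let L : Finset (Σ i, Fin (n i)) :=
      (univ.filter fun v : Σ i, Fin (n i) => v.1 = i ∨ v.1 = j).erase ⟨i, ⟨0, hpos i⟩⟩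
    have hL : #L = n i + n j - 1 := by
      rw [card_erase_of_mem (by simp), filter_or, card_union_of_disjoint, card_part, card_part]
      rw [disjoint_filter]
      rintro v - h1 h2
      exact hij (h1.symm.trans h2)
    let D : Finset (Sym2 (Σ i, Fin (n i))) :=
      ((univ : Finset (Fin (n κ))) ×ˢ L).image fun p => s(⟨κ, p.1⟩, p.2)
    have hD : #D ≤ n κ * (n i + n j - 1) := by
      refine card_image_le.trans ?_
      rw [card_product, card_univ, Fintype.card_fin, hL]
    let K : Finset (multipartite n).edgeSet := univ.filter fun e => (e : Sym2 _) ∉ D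
    have hfix : ∀ e ∈ K, r e = e := by
      intro e he
      by_cases h : ∃ u : Fin (n κ), (e : Sym2 _) ∈ edgesTo (⟨κ, u⟩ : Σ i, Fin (n i)) i j
      · obtain ⟨u, hu⟩ := h
        rw [hr u e hu]
        obtain ⟨v, hv, hev⟩ := hu
        by_cases hv0 : v = ⟨i, ⟨0, hpos i⟩⟩
        · apply Subtype.ext
          rw [hev, hv0]
        · exfalso
          refine (mem_filter.1 he).2 (mem_image.2 ⟨(u, v), ?_, hev.symm⟩)
          simp only [mem_product, mem_univ, true_and, L, mem_erase, mem_filter]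
          exact ⟨hv0, hv⟩
      · simp only [r, dif_neg h]
    have hKcard : #K ≤ numColors c₀ := by
      rw [← card_colors]
      refine card_le_card_of_injOn c₀ (fun e _ => mem_colors.2 ⟨e, rfl⟩) ?_
      intro e he f hf hef
      have h1 := ε.injective (Fin.ext hef)
      rwa [hfix e he, hfix f hf] at h1
    have hcompl : #(univ.filter fun e : (multipartite n).edgeSet => ¬ (e : Sym2 _) ∉ D) ≤ #D := by
      refine card_le_card_of_injOn (fun e => (e : Sym2 _)) (fun e he => ?_)
        (fun e _ f _ h => Subtype.ext h)
      have := (mem_filter.1 he).2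
      exact not_not.1 this
    have htot : #K + #(univ.filter fun e : (multipartite n).edgeSet => ¬ (e : Sym2 _) ∉ D) =
        Fintype.card (multipartite n).edgeSet := card_filter_add_card_filter_not _
    rw [Nat.card_eq_fintype_card]
    omega

/-- An extremal coloring loses at most `n κ * (n i + n j - 1)` colors. -/
theorem card_le_of_isExtremal (hpos : ∀ i, 0 < n i) {κ i j : Fin k} (hi : κ ≠ i) (hj : κ ≠ j)
    (hij : i ≠ j) {c : (multipartite n).EdgeLabeling ℕ}
    (hc : IsExtremal c (completeGraph (Fin k))) :
    Nat.card (multipartite n).edgeSet ≤ numColors c + n κ * (n i + n j - 1) := by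
  obtain ⟨c₀, h₀, h₁⟩ := exists_coloring hpos hi hj hij
  have : numColors c₀ ≤ numColors c := by
    rw [hc.2]
    refine le_csSup ⟨Nat.card (multipartite n).edgeSet, ?_⟩ ⟨c₀, h₀, rfl⟩
    rintro m ⟨d, -, rfl⟩
    exact numColors_le d
  omega

end Colorings

/-! ### Moving colorings along permutations of parts of equal size. -/

section Transport

variable {k : ℕ} {n : Fin k → ℕ}

/-- The automorphism of the complete multipartite graph that permutes partite sets of equal
sizes. -/
def permIso (π : Equiv.Perm (Fin k)) (hπ : ∀ i, n (π i) = n i) :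
    multipartite n ≃g multipartite n where
  toEquiv := Equiv.sigmaCongr π fun i => finCongr (hπ i).symm
  map_rel_iff' := by
    rintro ⟨i, x⟩ ⟨j, y⟩
    rw [multipartite_adj, multipartite_adj]
    exact π.injective.ne_iff

theorem permIso_fst (π : Equiv.Perm (Fin k)) (hπ : ∀ i, n (π i) = n i) (v : Σ i, Fin (n i)) :
    (permIso π hπ v).1 = π v.1 := rfl

theorem permIso_snd_val (π : Equiv.Perm (Fin k)) (hπ : ∀ i, n (π i) = n i) (v : Σ i, Fin (n i)) :
    ((permIso π hπ v).2 : ℕ) = v.2 := rfl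

theorem vertex_ext {v w : Σ i, Fin (n i)} (h : v.1 = w.1) (h' : (v.2 : ℕ) = w.2) : v = w := by
  obtain ⟨i, x⟩ := v
  obtain ⟨j, y⟩ := w
  obtain rfl : i = j := h
  obtain rfl : x = y := Fin.ext h'
  rfl

/-- The coloring that is obtained by moving a coloring along an automorphism. -/
def transport (c : (multipartite n).EdgeLabeling ℕ) (ρ : multipartite n ≃g multipartite n) :
    (multipartite n).EdgeLabeling ℕ :=
  fun e => c (ρ.mapEdgeSet.symm e)

theorem transport_apply (c : (multipartite n).EdgeLabeling ℕ)
    (ρ : multipartite n ≃g multipartite n) (e : (multipartite n).edgeSet) :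
    transport c ρ (ρ.mapEdgeSet e) = c e := by
  rw [transport, Equiv.symm_apply_apply]

theorem coloredIso_transport (c : (multipartite n).EdgeLabeling ℕ)
    (ρ : multipartite n ≃g multipartite n) : ColoredIso c (transport c ρ) := by
  have h : Set.range c = Set.range (transport c ρ) := by
    ext a
    constructor
    · rintro ⟨e, rfl⟩
      exact ⟨ρ.mapEdgeSet e, transport_apply c ρ e⟩
    · rintro ⟨e, rfl⟩
      exact ⟨ρ.mapEdgeSet.symm e, rfl⟩
  exact ⟨ρ, Equiv.setCongr h, fun e => (transport_apply c ρ e).symm⟩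

theorem coe_mapEdgeSet (ρ : multipartite n ≃g multipartite n) (e : (multipartite n).edgeSet) :
    (ρ.mapEdgeSet e : Sym2 _) = Sym2.map ρ e := rfl

theorem map_mem_edgesTo (π : Equiv.Perm (Fin k)) (hπ : ∀ i, n (π i) = n i) {u : Σ i, Fin (n i)}
    {i j : Fin k} {e : Sym2 (Σ i, Fin (n i))} :
    Sym2.map (permIso π hπ) e ∈ edgesTo (permIso π hπ u) (π i) (π j) ↔ e ∈ edgesTo u i j := by
  constructor
  · rintro ⟨v, hv, he⟩
    obtain ⟨w, rfl⟩ := (permIso π hπ).surjective v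
    rw [permIso_fst, π.injective.eq_iff, π.injective.eq_iff] at hv
    refine ⟨w, hv, Sym2.map.injective (permIso π hπ).injective ?_⟩
    rw [he, Sym2.map_mk]
  · rintro ⟨v, hv, rfl⟩
    refine ⟨permIso π hπ v, ?_, Sym2.map_mk _ _ _⟩
    rw [permIso_fst, π.injective.eq_iff, π.injective.eq_iff]
    exact hv

theorem edgesTo_comm (u : Σ i, Fin (n i)) (i j : Fin k) : edgesTo u i j = edgesTo u j i := by
  ext e
  simp only [edgesTo, or_comm]

theorem swap_size {p q : Fin k} (h : n p = n q) (i : Fin k) : n (Equiv.swap p q i) = n i := by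
  by_cases h1 : i = p
  · rw [h1, Equiv.swap_apply_left, h]
  · by_cases h2 : i = q
    · rw [h2, Equiv.swap_apply_right, h]
    · rw [Equiv.swap_apply_of_ne_of_ne h1 h2]

end Transport

/-! ### From full stars to type 3. -/

section TypeThree

variable {k : ℕ} {n : Fin k → ℕ}

theorem lt_fromEnd_zero (hk : 0 < k) {i : Fin k} (h : i ≠ fromEnd 0 hk) : i < fromEnd 0 hk := by
  rw [Fin.lt_def]
  have h' : (i : ℕ) ≠ (fromEnd 0 hk : Fin k) := fun h' => h (Fin.ext h')
  simp only [fromEnd, Fin.val_rev] at h' ⊢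
  omega

theorem card_of_two_le_ecount {F : Finset (Sym2 (Σ i, Fin (n i)))} {t : ∀ i, Fin (n i)}
    (h : 2 ≤ ecount F t) : 2 ≤ #F := by
  obtain ⟨e, he, f, hf, hef, -⟩ := exists_of_two_le_ecount h
  exact one_lt_card.2 ⟨e, he, f, hf, hef⟩

theorem two_le_card_colorClass {c : (multipartite n).EdgeLabeling ℕ}
    {e f : (multipartite n).edgeSet} (h : c e = c f) (hne : e ≠ f) : 2 ≤ #(colorClass c (c e)) :=
  one_lt_card.2 ⟨e, coe_mem_colorClass.2 rfl, f, coe_mem_colorClass.2 h.symm,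
    fun h' => hne (Subtype.ext h')⟩

theorem exists_transversal_vertex (hpos : ∀ i, 0 < n i) (v : Σ i, Fin (n i)) :
    ∃ t : ∀ i, Fin (n i), t v.1 = v.2 :=
  ⟨Function.update (fun i => ⟨0, hpos i⟩) v.1 v.2, Function.update_self _ _ _⟩

/-- If the nontrivial color classes are full stars, their centers form one partite set. -/
theorem exists_center_part (hpos : ∀ i, 0 < n i) {c : (multipartite n).EdgeLabeling ℕ}
    (hc : ¬ HasRainbow c (completeGraph (Fin k)))
    (huniq : ∀ t, ∀ a ∈ colors c, ∀ b ∈ colors c, 2 ≤ ecount (colorClass c a) t →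
      2 ≤ ecount (colorClass c b) t → a = b) {m M : ℕ}
    (hstar : ∀ a ∈ colors c, 2 ≤ #(colorClass c a) → IsFullStar (colorClass c a) m M) :
    ∃ p : Fin k, n p = m ∧ ∃ i j : Fin (n p) → Fin k,
      (∀ u, i u ≠ j u ∧ p ≠ i u ∧ p ≠ j u ∧ n (i u) + n (j u) = M) ∧
      ∀ e f : (multipartite n).edgeSet, c e = c f ↔ e = f ∨
        ∃ u, (e : Sym2 _) ∈ edgesTo ⟨p, u⟩ (i u) (j u) ∧ (f : Sym2 _) ∈ edgesTo ⟨p, u⟩ (i u) (j u) := by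
  obtain ⟨a₀, ha₀, hat₀⟩ := exists_color_of_not_hasRainbow hc fun i => ⟨0, hpos i⟩
  have h20 := card_of_two_le_ecount hat₀
  obtain ⟨y₀, i₀, -⟩ := hstar a₀ ha₀ h20
  have : Nonempty (Fin k) := ⟨i₀⟩
  have : Nonempty (Σ i, Fin (n i)) := ⟨y₀⟩
  choose! y i j hij hyi hyj hym hM hmem using hstar
  -- A transversal through the center of a full star meets both of its parts and so spans two of its
  -- edges; by `hin`, it spans two edges only if it passes through the center.
  have hkill : ∀ a ∈ colors c, 2 ≤ #(colorClass c a) → ∀ t : ∀ i, Fin (n i),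
      t (y a).1 = (y a).2 → 2 ≤ ecount (colorClass c a) t := by
    intro a ha h2 t ht
    refine two_le_ecount ((hmem a ha h2 _).2 ⟨⟨i a, t (i a)⟩, Or.inl rfl, rfl⟩)
      ((hmem a ha h2 _).2 ⟨⟨j a, t (j a)⟩, Or.inr rfl, rfl⟩) ?_ (by simp [ht]) (by simp [ht])
    intro h
    rw [Sym2.congr_right] at h
    exact hij a ha h2 (congrArg Sigma.fst h)
  have hin : ∀ a ∈ colors c, ∀ t : ∀ i, Fin (n i), 2 ≤ ecount (colorClass c a) t →
      t (y a).1 = (y a).2 := by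
    intro a ha t ht
    obtain ⟨e, he, -, -, -, het, -⟩ := exists_of_two_le_ecount ht
    obtain ⟨w, -, rfl⟩ := (hmem a ha (card_of_two_le_ecount ht) e).1 he
    exact het (y a) (Sym2.mem_mk_left _ _)
  -- Centers in different parts lie on a common transversal, on which both colors would occur twice.
  have hpart : ∀ a ∈ colors c, 2 ≤ #(colorClass c a) → (y a).1 = (y a₀).1 := by
    intro a ha h2
    by_contra hne
    obtain ⟨t, h1, h3⟩ := exists_transversal_edge hpos hne
    exact hne (by rw [huniq t a ha a₀ ha₀ (hkill a ha h2 t h1) (hkill a₀ ha₀ h20 t h3)])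
  -- Some color occurs twice on a transversal through `u`, and its center has to be `u`.
  have hex : ∀ u : Fin (n (y a₀).1), ∃ a ∈ colors c, 2 ≤ #(colorClass c a) ∧
      y a = ⟨(y a₀).1, u⟩ := by
    intro u
    obtain ⟨t, ht⟩ := exists_transversal_vertex hpos ⟨(y a₀).1, u⟩
    obtain ⟨a, ha, hat⟩ := exists_color_of_not_hasRainbow hc t
    have h2 := card_of_two_le_ecount hat
    refine ⟨a, ha, h2, vertex_ext (hpart a ha h2) ?_⟩
    rw [← hin a ha t hat, hpart a ha h2, ht]
  choose a ha h2 hy using hex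
  refine ⟨(y a₀).1, hym a₀ ha₀ h20, fun u => i (a u), fun u => j (a u), fun u => ?_,
    fun e f => ?_⟩
  · have h1 := hyi (a u) (ha u) (h2 u)
    have h3 := hyj (a u) (ha u) (h2 u)
    rw [hpart _ (ha u) (h2 u)] at h1 h3
    exact ⟨hij _ (ha u) (h2 u), h1, h3, hM _ (ha u) (h2 u)⟩
  · have hcl : ∀ u, ∀ e : Sym2 _, e ∈ edgesTo ⟨(y a₀).1, u⟩ (i (a u)) (j (a u)) ↔
        e ∈ colorClass c (a u) := by
      intro u e
      rw [hmem _ (ha u) (h2 u), hy u]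
      rfl
    simp only [hcl, coe_mem_colorClass]
    constructor
    · intro hef
      by_cases hne : e = f
      · exact Or.inl hne
      · right
        have hc2 := two_le_card_colorClass hef hne
        have hce : c e ∈ colors c := mem_colors.2 ⟨e, rfl⟩
        obtain ⟨u, hu⟩ : ∃ u, y (c e) = ⟨(y a₀).1, u⟩ := by
          have := hpart _ hce hc2
          generalize y (c e) = z at this
          obtain ⟨q, x⟩ := z
          simp only at this
          subst this
          exact ⟨x, rfl⟩
        obtain ⟨t, ht⟩ := exists_transversal_vertex hpos (y (c e))
        have : c e = a u := huniq t _ hce _ (ha u) (hkill _ hce hc2 t ht)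
          (hkill _ (ha u) (h2 u) t (by rw [hy u, ← hu, ht]))
        exact ⟨u, this, hef ▸ this⟩
    · rintro (rfl | ⟨u, h1, h2⟩)
      · rfl
      · rw [h1, h2]

/-- The part of the centers has the size of the last part, so the two can be swapped. The swap may
reverse the order of the two assigned parts, hence the minimum and maximum. -/
theorem exists_isType3 (hk : 3 ≤ k) {c : (multipartite n).EdgeLabeling ℕ} {p : Fin k}
    (hp : n p = n (fromEnd 0 (by omega))) {i j : Fin (n p) → Fin k}
    (hij : ∀ u, i u ≠ j u ∧ p ≠ i u ∧ p ≠ j u ∧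
      n (i u) + n (j u) = n (fromEnd 2 (by omega)) + n (fromEnd 1 (by omega)))
    (hc : ∀ e f : (multipartite n).edgeSet, c e = c f ↔ e = f ∨
        ∃ u, (e : Sym2 _) ∈ edgesTo ⟨p, u⟩ (i u) (j u) ∧ (f : Sym2 _) ∈ edgesTo ⟨p, u⟩ (i u) (j u)) :
    ∃ c' : (multipartite n).EdgeLabeling ℕ, ColoredIso c c' ∧ IsType3 hk c' := by
  set κ : Fin k := fromEnd 0 (by omega) with hκ
  set π := Equiv.swap p κ
  have hπ := swap_size (n := n) hp
  have hπκ : ∀ q, p ≠ q → π q < κ := by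
    intro q hq
    refine lt_fromEnd_zero _ ?_
    rw [← hκ, ← Equiv.swap_apply_left p κ]
    exact π.injective.ne hq.symm
  refine ⟨transport c (permIso π hπ), coloredIso_transport _ _,
    fun s => min (π (i (Fin.cast hp.symm s))) (π (j (Fin.cast hp.symm s))),
    fun s => max (π (i (Fin.cast hp.symm s))) (π (j (Fin.cast hp.symm s))), fun s => ?_,
    fun e f => ?_⟩
  · obtain ⟨h1, h2, h3, h4⟩ := hij (Fin.cast hp.symm s)
    refine ⟨?_, max_lt (hπκ _ h2) (hπκ _ h3), ?_⟩
    · exact inf_lt_sup.2 (π.injective.ne h1)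
    · rw [← h4, ← hπ (i _), ← hπ (j _)]
      dsimp only
      rcases le_total (π (i (Fin.cast hp.symm s))) (π (j (Fin.cast hp.symm s))) with h | h
      · rw [min_eq_left h, max_eq_right h]
      · rw [min_eq_right h, max_eq_left h, add_comm]
  · obtain ⟨e, rfl⟩ := (permIso π hπ).mapEdgeSet.surjective e
    obtain ⟨f, rfl⟩ := (permIso π hπ).mapEdgeSet.surjective f
    rw [transport_apply, transport_apply, hc, (permIso π hπ).mapEdgeSet.injective.eq_iff]
    refine or_congr_right ?_
    have hmm : ∀ (s : Fin (n κ)) (g : (multipartite n).edgeSet),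
        ((permIso π hπ).mapEdgeSet g : Sym2 _) ∈ edgesTo ⟨κ, s⟩
          (min (π (i (Fin.cast hp.symm s))) (π (j (Fin.cast hp.symm s))))
          (max (π (i (Fin.cast hp.symm s))) (π (j (Fin.cast hp.symm s)))) ↔
        (g : Sym2 _) ∈ edgesTo ⟨p, Fin.cast hp.symm s⟩ (i (Fin.cast hp.symm s))
          (j (Fin.cast hp.symm s)) := by
      intro s g
      have hv : (⟨κ, s⟩ : Σ i, Fin (n i)) = permIso π hπ ⟨p, Fin.cast hp.symm s⟩ :=
        vertex_ext (Equiv.swap_apply_left p κ).symm rfl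
      rw [← map_mem_edgesTo π hπ (e := (g : Sym2 _)), coe_mapEdgeSet, hv]
      rcases le_total (π (i (Fin.cast hp.symm s))) (π (j (Fin.cast hp.symm s))) with h | h
      · rw [min_eq_left h, max_eq_right h]
      · rw [min_eq_right h, max_eq_left h, edgesTo_comm]
    constructor
    · rintro ⟨u, h1, h2⟩
      exact ⟨Fin.cast hp u, (hmm _ e).2 h1, (hmm _ f).2 h2⟩
    · rintro ⟨s, h1, h2⟩
      exact ⟨Fin.cast hp.symm s, (hmm _ e).1 h1, (hmm _ f).1 h2⟩

end TypeThree

/-! ### From two disjoint edges on four unit parts to type 1. -/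

section TypeOne

variable {k : ℕ} {n : Fin k → ℕ}

/-- A permutation of the partite sets of size one with prescribed values. -/
theorem exists_perm_unit {m : ℕ} {f g : Fin m → Fin k} (hf : Function.Injective f)
    (hg : Function.Injective g) (hf1 : ∀ x, n (f x) = 1) (hg1 : ∀ x, n (g x) = 1) :
    ∃ π : Equiv.Perm (Fin k), (∀ i, n (π i) = n i) ∧ ∀ x, π (f x) = g x := by
  obtain ⟨σ, hσ⟩ := Equiv.Perm.exists_extending_pair
    (fun x => (⟨f x, hf1 x⟩ : {i // n i = 1})) (fun x => (⟨g x, hg1 x⟩ : {i // n i = 1}))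
    (fun x y h => hf (congrArg Subtype.val h)) (fun x y h => hg (congrArg Subtype.val h))
  refine ⟨Equiv.Perm.ofSubtype σ, fun i => ?_, fun x => ?_⟩
  · by_cases hi : n i = 1
    · rw [Equiv.Perm.ofSubtype_apply_of_mem σ hi, hi]
      exact (σ ⟨i, hi⟩).2
    · rw [Equiv.Perm.ofSubtype_apply_of_not_mem σ hi]
  · rw [Equiv.Perm.ofSubtype_apply_of_mem σ (hf1 x)]
    exact congrArg Subtype.val (hσ x)

theorem exists_isType1 (hn : Antitone n) (hpos : ∀ i, 0 < n i)
    {c : (multipartite n).EdgeLabeling ℕ} {v : Fin 4 → Σ i, Fin (n i)}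
    (hv : Function.Injective fun x => (v x).1) (hunit : ∀ x, n (v x).1 = 1)
    (hc : ∀ e f : (multipartite n).edgeSet, c e = c f ↔ e = f ∨
      ((e : Sym2 _) = s(v 0, v 1) ∧ (f : Sym2 _) = s(v 2, v 3)) ∨
      ((f : Sym2 _) = s(v 0, v 1) ∧ (e : Sym2 _) = s(v 2, v 3))) :
    ∃ c' : (multipartite n).EdgeLabeling ℕ, ColoredIso c c' ∧ IsType1 hpos c' := by
  have hk : 4 ≤ k := by simpa using Fintype.card_le_of_injective _ hv
  -- The sizes decrease, so otherwise all unit parts would be among the last three, leaving no room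
  -- for four of them.
  have h3 : n (fromEnd 3 (by omega)) = 1 := by
    by_contra hne
    have hgt : ∀ x, k - 4 < ((v x).1 : ℕ) := by
      intro x
      by_contra! hle
      have h1 : (v x).1 ≤ fromEnd 3 (by omega) := by
        rw [Fin.le_def]
        simp only [fromEnd, Fin.val_rev]
        omega
      have := hn h1
      rw [hunit x] at this
      have := hpos (fromEnd 3 (by omega))
      omega
    have hval : ∀ x y, x ≠ y → ((v x).1 : ℕ) ≠ (v y).1 := fun x y hxy h =>
      hxy (hv (Fin.ext h))
    have b0 := hgt 0
    have b1 := hgt 1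
    have b2 := hgt 2
    have b3 := hgt 3
    have c0 := (v 0).1.2
    have c1 := (v 1).1.2
    have c2 := (v 2).1.2
    have c3 := (v 3).1.2
    have d1 := hval 0 1 (by decide)
    have d2 := hval 0 2 (by decide)
    have d3 := hval 0 3 (by decide)
    have d4 := hval 1 2 (by decide)
    have d5 := hval 1 3 (by decide)
    have d6 := hval 2 3 (by decide)
    omega
  let w : Fin 4 → Fin k := fun x => fromEnd (3 - x) (by omega)
  have hw : Function.Injective w := by
    intro x y h
    have h' := congrArg Fin.val h
    simp only [w, fromEnd, Fin.val_rev] at h'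
    apply Fin.ext
    omega
  have hw1 : ∀ x, n (w x) = 1 := by
    intro x
    refine le_antisymm ?_ (hpos _)
    rw [← h3]
    apply hn
    rw [Fin.le_def]
    simp only [w, fromEnd, Fin.val_rev]
    omega
  obtain ⟨π, hπ, hπv⟩ := exists_perm_unit hv hw hunit hw1
  have hmap : ∀ x, permIso π hπ (v x) = firstVertex hpos (3 - x) (by omega) := by
    intro x
    refine vertex_ext (hπv x) ?_
    rw [permIso_snd_val]
    have := (v x).2.2
    have := hunit x
    simp only [firstVertex]
    omega
  have hedge : ∀ (x y : Fin 4) (e : (multipartite n).edgeSet),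
      ((permIso π hπ).mapEdgeSet e : Sym2 _) =
        s(firstVertex hpos (3 - x) (by omega), firstVertex hpos (3 - y) (by omega)) ↔
      (e : Sym2 _) = s(v x, v y) := by
    intro x y e
    rw [← hmap, ← hmap, coe_mapEdgeSet, ← Sym2.map_mk,
      (Sym2.map.injective (permIso π hπ).injective).eq_iff]
  refine ⟨transport c (permIso π hπ), coloredIso_transport _ _, hk, h3, fun e f => ?_⟩
  obtain ⟨e, rfl⟩ := (permIso π hπ).mapEdgeSet.surjective e
  obtain ⟨f, rfl⟩ := (permIso π hπ).mapEdgeSet.surjective f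
  rw [transport_apply, transport_apply, hc, (permIso π hπ).mapEdgeSet.injective.eq_iff]
  exact or_congr_right (or_congr (and_congr (hedge 0 1 e).symm (hedge 2 3 f).symm)
    (and_congr (hedge 0 1 f).symm (hedge 2 3 e).symm))

end TypeOne

/-! ### Tight classes for exactly two unit parts, and the book they form. -/

section TypeTwo

variable {k : ℕ} {n : Fin k → ℕ}

theorem apply_of_unit {X : Σ i, Fin (n i)} (hX : n X.1 = 1) (t : ∀ i, Fin (n i)) :
    t X.1 = X.2 := by
  apply Fin.ext
  have h1 := (t X.1).2
  have h2 := X.2.2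
  omega

/-- Two parts of size at least `a` would give a product of at least `a * a > a`, and two unit parts
would give 1. So exactly one end is `X` or `Y`. -/
theorem form_of_size {X Y : Σ i, Fin (n i)} (hX : n X.1 = 1) (hY : n Y.1 = 1) {a : ℕ}
    (ha : 2 ≤ a) (hI : ∀ i, i ≠ X.1 → i ≠ Y.1 → a ≤ n i) {v w : Σ i, Fin (n i)}
    (hvw : n v.1 * n w.1 = a) :
    ∃ r, r ≠ X.1 ∧ r ≠ Y.1 ∧ n r = a ∧ ∃ x, s(v, w) = s(X, ⟨r, x⟩) ∨ s(v, w) = s(Y, ⟨r, x⟩) := by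
  have key : ∀ v w : Σ i, Fin (n i), n v.1 * n w.1 = a → (v.1 = X.1 ∨ v.1 = Y.1) →
      ∃ r, r ≠ X.1 ∧ r ≠ Y.1 ∧ n r = a ∧
        ∃ x, s(v, w) = s(X, ⟨r, x⟩) ∨ s(v, w) = s(Y, ⟨r, x⟩) := by
    intro v w hvw hv
    have hnv : n v.1 = 1 := by rcases hv with h | h <;> rw [h] <;> assumption
    rw [hnv, one_mul] at hvw
    refine ⟨w.1, fun h => ?_, fun h => ?_, hvw, w.2, ?_⟩
    · rw [h, hX] at hvw; omega
    · rw [h, hY] at hvw; omega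
    · rcases hv with h | h
      · left; rw [eq_of_unit_part hX h rfl]
      · right; rw [eq_of_unit_part hY h rfl]
  by_cases hv : v.1 = X.1 ∨ v.1 = Y.1
  · exact key v w hvw hv
  · by_cases hw : w.1 = X.1 ∨ w.1 = Y.1
    · rw [Sym2.eq_swap]
      exact key w v (by rw [mul_comm, hvw]) hw
    · exfalso
      push Not at hv hw
      have h1 := hI _ hv.1 hv.2
      have h2 := hI _ hw.1 hw.2
      have h3 := Nat.mul_le_mul h1 h2
      rw [hvw] at h3
      nlinarith

/-- The tight color classes in the presence of exactly two partite sets of size one. -/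
theorem book_class (hpos : ∀ i, 0 < n i) {X Y : Σ i, Fin (n i)}
    (hX : n X.1 = 1) (hY : n Y.1 = 1) {a : ℕ} (ha : 2 ≤ a)
    (hI : ∀ i, i ≠ X.1 → i ≠ Y.1 → a ≤ n i) {F : Finset (Sym2 (Σ i, Fin (n i)))}
    (hcr : Crossing F) (h2 : 2 ≤ #F)
    (heq : a * mean (fun t => (ind (2 ≤ ecount F t) : ℚ)) = #F - 1) :
    ∃ r, (r ≠ X.1 ∧ r ≠ Y.1 ∧ n r = a) ∧
      (∀ e ∈ F, e = s(X, Y) ∨ ∃ x, e = s(X, ⟨r, x⟩) ∨ e = s(Y, ⟨r, x⟩)) ∧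
      (∃ x, ∀ t, t r = x → 2 ≤ ecount F t) ∧
      (s(X, Y) ∈ F → ∀ x, ¬ (s(X, ⟨r, x⟩) ∈ F ∧ s(Y, ⟨r, x⟩) ∈ F)) ∧
      (s(X, Y) ∉ F → ∃ x, ∀ e ∈ F, e = s(X, ⟨r, x⟩) ∨ e = s(Y, ⟨r, x⟩)) := by
  classical
  have hne : F.Nonempty := card_pos.1 (by omega)
  have hb := (unit_bound hpos hX hY (by omega : 0 < a) hI hne hcr).2 heq
  have hform : ∀ e₀ ∈ F, (s(X, Y) ∈ F → e₀ = s(X, Y)) → ∀ e ∈ F, e ≠ e₀ →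
      ∃ r, r ≠ X.1 ∧ r ≠ Y.1 ∧ n r = a ∧ ∃ x, e = s(X, ⟨r, x⟩) ∨ e = s(Y, ⟨r, x⟩) := by
    intro e₀ he₀ hg e he hee
    induction e with | _ v w =>
    exact form_of_size hX hY ha hI ((hb e₀ he₀ hg).2 v w he hee)
  have hhit : ∀ {e : Sym2 (Σ i, Fin (n i))} {r : Fin k} {x : Fin (n r)} (t : ∀ i, Fin (n i)),
      (e = s(X, ⟨r, x⟩) ∨ e = s(Y, ⟨r, x⟩)) → ((∀ v ∈ e, t v.1 = v.2) ↔ t r = x) := by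
    rintro e r x t (rfl | rfl)
    · simp [apply_of_unit hX t]
    · simp [apply_of_unit hY t]
  by_cases hg : s(X, Y) ∈ F
  · have hgt : ∀ t : ∀ i, Fin (n i), ∀ v ∈ s(X, Y), t v.1 = v.2 := by
      intro t v hv
      rw [Sym2.mem_iff] at hv
      rcases hv with rfl | rfl
      · exact apply_of_unit hX t
      · exact apply_of_unit hY t
    -- The spine lies on all transversals, so the equality case says that a transversal spans at
    -- most one further edge of `F`. Hence all these edges lead to one part and no page contributes
    -- both of its edges.
    have hle : ∀ t, ecount (F.erase s(X, Y)) t ≤ 1 := by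
      intro t
      have h1 := (hb _ hg fun _ => rfl).1 t
      have h3 : ecount (F.erase s(X, Y)) t + ind (∀ v ∈ s(X, Y), t v.1 = v.2) = ecount F t :=
        sum_erase_add _ _ hg
      have h4 := ind_le_one (2 ≤ ecount F t)
      omega
    obtain ⟨e₁, he₁, hne₁⟩ : ∃ e ∈ F, e ≠ s(X, Y) := by
      obtain ⟨e, he, f, hf, hef⟩ := one_lt_card.1 h2
      by_cases h : e = s(X, Y)
      · exact ⟨f, hf, fun h' => hef (h.trans h'.symm)⟩
      · exact ⟨e, he, h⟩
    obtain ⟨r, hrX, hrY, hr, x, hx⟩ := hform _ hg (fun _ => rfl) e₁ he₁ hne₁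
    refine ⟨r, ⟨hrX, hrY, hr⟩, fun e he => ?_, ⟨x, fun t ht => ?_⟩, fun _ y hy => ?_,
      fun h => absurd hg h⟩
    · by_cases hne : e = s(X, Y)
      · exact Or.inl hne
      right
      obtain ⟨r', hrX', hrY', hr', x', hx'⟩ := hform _ hg (fun _ => rfl) e he hne
      have hrr : r' = r := by
        by_contra hrr
        obtain ⟨t, h1, h3⟩ := exists_transversal_edge hpos (v := ⟨r', x'⟩) (w := ⟨r, x⟩) hrr
        have hee : e ≠ e₁ := by
          rintro rfl
          have hm : (⟨r', x'⟩ : Σ i, Fin (n i)) ∈ e := by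
            rcases hx' with h | h <;> simp [h]
          rcases hx with h | h <;>
          · rw [h, Sym2.mem_iff] at hm
            rcases hm with hm | hm
            · have := congrArg Sigma.fst hm
              simp only at this
              first
                | exact hrX' this
                | exact hrY' this
            · exact hrr (congrArg Sigma.fst hm)
        have := two_le_ecount (mem_erase.2 ⟨hne, he⟩) (mem_erase.2 ⟨hne₁, he₁⟩) hee
          ((hhit t hx').2 h1) ((hhit t hx).2 h3)
        have := hle t
        omega
      subst hrr
      exact ⟨x', hx'⟩
    · exact two_le_ecount he₁ hg hne₁ ((hhit t hx).2 ht) (hgt t)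
    · obtain ⟨t, ht⟩ := exists_transversal_vertex hpos ⟨r, y⟩
      have hXY : s(X, (⟨r, y⟩ : Σ i, Fin (n i))) ≠ s(Y, ⟨r, y⟩) := by
        intro h
        rw [Sym2.congr_left] at h
        subst h
        exact hcr _ _ hg rfl
      have hne' : ∀ Z : Σ i, Fin (n i), s(Z, (⟨r, y⟩ : Σ i, Fin (n i))) ≠ s(X, Y) := by
        intro Z h
        have hm : (⟨r, y⟩ : Σ i, Fin (n i)) ∈ s(X, Y) := by rw [← h]; simp
        rw [Sym2.mem_iff] at hm
        rcases hm with hm | hm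
        · exact hrX (congrArg Sigma.fst hm)
        · exact hrY (congrArg Sigma.fst hm)
      have := two_le_ecount (t := t) (mem_erase.2 ⟨hne' _, hy.1⟩) (mem_erase.2 ⟨hne' _, hy.2⟩) hXY
        ((hhit t (Or.inl rfl)).2 ht) ((hhit t (Or.inr rfl)).2 ht)
      have := hle t
      omega
  · have hform' : ∀ e ∈ F, ∃ r, r ≠ X.1 ∧ r ≠ Y.1 ∧ n r = a ∧
        ∃ x, e = s(X, ⟨r, x⟩) ∨ e = s(Y, ⟨r, x⟩) := by
      intro e he
      obtain ⟨f, hf, hfe⟩ := exists_mem_ne h2 e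
      exact hform f hf (fun h => absurd h hg) e he hfe.symm
    -- Without the spine any edge of `F` may play the role of `e₀`. A transversal spanning `e` but
    -- not `e₀` would have `ecount` equal to an indicator of `2 ≤ ecount`, which is impossible for a
    -- positive count.
    have himp : ∀ e ∈ F, ∀ e₀ ∈ F, e ≠ e₀ → ∀ t : ∀ i, Fin (n i),
        (∀ v ∈ e, t v.1 = v.2) → ∀ v ∈ e₀, t v.1 = v.2 := by
      intro e he e₀ he₀ hee t ht
      by_contra hcon
      have h1 := (hb e₀ he₀ fun h => absurd h hg).1 t
      rw [ind_not hcon, add_zero] at h1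
      have h3 := ecount_pos.2 ⟨e, he, ht⟩
      have h4 := ind_le_one (2 ≤ ecount F t)
      have h5 : ind (2 ≤ ecount F t) = 0 := ind_not (by omega)
      omega
    obtain ⟨e₁, he₁⟩ := hne
    obtain ⟨e₂, he₂, he₂₁⟩ := exists_mem_ne h2 e₁
    obtain ⟨r, hrX, hrY, hr, x, hx⟩ := hform' e₁ he₁
    have hall : ∀ e ∈ F, e = s(X, ⟨r, x⟩) ∨ e = s(Y, ⟨r, x⟩) := by
      intro e he
      by_cases hee : e = e₁
      · rw [hee]; exact hx
      obtain ⟨r', -, -, hr', x', hx'⟩ := hform' e he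
      have himp' : ∀ t : ∀ i, Fin (n i), t r = x → t r' = x' := fun t ht =>
        (hhit t hx').1 (himp e₁ he₁ e he (Ne.symm hee) t ((hhit t hx).2 ht))
      have hrr : r' = r := by
        by_contra hrr
        -- The part `r'` has at least two vertices, so the choice in part `r` cannot determine the
        -- choice in a different part `r'`.
        obtain ⟨z, hz⟩ : ∃ z : Fin (n r'), z ≠ x' := by
          have : Nontrivial (Fin (n r')) := Fin.nontrivial_iff_two_le.2 (by omega)
          exact exists_ne _
        obtain ⟨t, h1, h3⟩ := exists_transversal_edge hpos (v := ⟨r', z⟩) (w := ⟨r, x⟩) hrr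
        exact hz (h1.symm.trans (himp' t h3))
      subst hrr
      obtain ⟨t, ht⟩ := exists_transversal_vertex hpos ⟨r', x⟩
      have : x = x' := ht.symm.trans (himp' t ht)
      rw [this]
      exact hx'
    refine ⟨r, ⟨hrX, hrY, hr⟩, fun e he => Or.inr ⟨x, hall e he⟩, ⟨x, fun t ht => ?_⟩,
      fun h => absurd h hg, fun _ => ⟨x, hall⟩⟩
    exact two_le_ecount he₁ he₂ he₂₁.symm ((hhit t hx).2 ht) ((hhit t (hall e₂ he₂)).2 ht)

/-- The colors of the edges of the book with the pages `r`. -/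
theorem exists_book (hpos : ∀ i, 0 < n i) {c : (multipartite n).EdgeLabeling ℕ}
    (hc : ¬ HasRainbow c (completeGraph (Fin k)))
    (huniq : ∀ t, ∀ a ∈ colors c, ∀ b ∈ colors c, 2 ≤ ecount (colorClass c a) t →
      2 ≤ ecount (colorClass c b) t → a = b)
    {X Y : Σ i, Fin (n i)} (hXY : X.1 ≠ Y.1) {m : ℕ}
    (hclass : ∀ a ∈ colors c, 2 ≤ #(colorClass c a) → ∃ r, (r ≠ X.1 ∧ r ≠ Y.1 ∧ n r = m) ∧
      (∀ e ∈ colorClass c a, e = s(X, Y) ∨ ∃ x, e = s(X, ⟨r, x⟩) ∨ e = s(Y, ⟨r, x⟩)) ∧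
      (∃ x, ∀ t, t r = x → 2 ≤ ecount (colorClass c a) t) ∧
      (s(X, Y) ∈ colorClass c a →
        ∀ x, ¬ (s(X, ⟨r, x⟩) ∈ colorClass c a ∧ s(Y, ⟨r, x⟩) ∈ colorClass c a)) ∧
      (s(X, Y) ∉ colorClass c a →
        ∃ x, ∀ e ∈ colorClass c a, e = s(X, ⟨r, x⟩) ∨ e = s(Y, ⟨r, x⟩))) :
    ∃ r, ∃ (hrX : X.1 ≠ r) (hrY : Y.1 ≠ r), n r = m ∧
      (∃ a : Fin (n r) → ℕ, Function.Injective a ∧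
        (∀ x, a x ≠ c ⟨s(X, Y), multipartite_adj.2 hXY⟩) ∧
        ∀ x, (c ⟨s(X, ⟨r, x⟩), multipartite_adj.2 hrX⟩ = a x ∧
              c ⟨s(Y, ⟨r, x⟩), multipartite_adj.2 hrY⟩ = a x) ∨
            (c ⟨s(X, ⟨r, x⟩), multipartite_adj.2 hrX⟩ = a x ∧
              c ⟨s(Y, ⟨r, x⟩), multipartite_adj.2 hrY⟩ = c ⟨s(X, Y), multipartite_adj.2 hXY⟩) ∨
            (c ⟨s(X, ⟨r, x⟩), multipartite_adj.2 hrX⟩ = c ⟨s(X, Y), multipartite_adj.2 hXY⟩ ∧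
              c ⟨s(Y, ⟨r, x⟩), multipartite_adj.2 hrY⟩ = a x)) ∧
      ∀ e f : (multipartite n).edgeSet, c e = c f → e = f ∨
        ((∀ v ∈ (e : Sym2 _), v = X ∨ v = Y ∨ v.1 = r) ∧
          ∀ v ∈ (f : Sym2 _), v = X ∨ v = Y ∨ v.1 = r) := by
  have : Nonempty (Fin k) := ⟨X.1⟩
  obtain ⟨a₀, ha₀, hat₀⟩ := exists_color_of_not_hasRainbow hc fun i => ⟨0, hpos i⟩
  have h20 := card_of_two_le_ecount hat₀
  choose! r' hr' hform' hkill' hboth' hnot' using hclass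
  -- Classes with pages in different parts would occur twice on a common transversal.
  have hrr : ∀ a ∈ colors c, 2 ≤ #(colorClass c a) → r' a = r' a₀ := by
    intro a ha h2
    by_contra hne
    obtain ⟨x, hx⟩ := hkill' a ha h2
    obtain ⟨y, hy⟩ := hkill' a₀ ha₀ h20
    obtain ⟨t, h1, h3⟩ := exists_transversal_edge hpos (v := ⟨r' a, x⟩) (w := ⟨r' a₀, y⟩) hne
    exact hne (by rw [huniq t a ha a₀ ha₀ (hx t h1) (hy t h3)])
  obtain ⟨hrX, hrY, hrm⟩ := hr' a₀ ha₀ h20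
  set r := r' a₀ with hr
  have hform : ∀ a ∈ colors c, 2 ≤ #(colorClass c a) → ∀ e ∈ colorClass c a,
      e = s(X, Y) ∨ ∃ x, e = s(X, ⟨r, x⟩) ∨ e = s(Y, ⟨r, x⟩) := by
    intro a ha h2
    have := hform' a ha h2
    rwa [hrr a ha h2] at this
  have hboth : ∀ a ∈ colors c, 2 ≤ #(colorClass c a) → s(X, Y) ∈ colorClass c a →
        ∀ x, ¬ (s(X, ⟨r, x⟩) ∈ colorClass c a ∧ s(Y, ⟨r, x⟩) ∈ colorClass c a) := by
    intro a ha h2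
    have := hboth' a ha h2
    rwa [hrr a ha h2] at this
  have hnot : ∀ a ∈ colors c, 2 ≤ #(colorClass c a) → s(X, Y) ∉ colorClass c a →
        ∃ x, ∀ e ∈ colorClass c a, e = s(X, ⟨r, x⟩) ∨ e = s(Y, ⟨r, x⟩) := by
    intro a ha h2
    have := hnot' a ha h2
    rwa [hrr a ha h2] at this
  set g : (multipartite n).edgeSet := ⟨s(X, Y), multipartite_adj.2 hXY⟩ with hg
  set eX : Fin (n r) → (multipartite n).edgeSet := fun x =>
    ⟨s(X, ⟨r, x⟩), multipartite_adj.2 hrX.symm⟩ with heX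
  set eY : Fin (n r) → (multipartite n).edgeSet := fun x =>
    ⟨s(Y, ⟨r, x⟩), multipartite_adj.2 hrY.symm⟩ with heY
  have hmem : ∀ e : (multipartite n).edgeSet, ∀ f, c e = c f ↔ (f : Sym2 _) ∈ colorClass c (c e) :=
    fun e f => by rw [coe_mem_colorClass, eq_comm]
  have hXne : ∀ x, eX x ≠ g := by
    intro x h
    have h' := congrArg Subtype.val h
    simp only [hg, heX, Sym2.congr_right] at h'
    exact hrY (congrArg Sigma.fst h')
  have hXYne : ∀ x y, eX x ≠ eY y := by
    intro x y h
    have h' := congrArg Subtype.val h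
    simp only [heX, heY, Sym2.eq_iff] at h'
    rcases h' with ⟨h', -⟩ | ⟨h', -⟩
    · exact hXY (congrArg Sigma.fst h')
    · exact hrX (congrArg Sigma.fst h').symm
  have hinj : ∀ (e : (multipartite n).edgeSet) (x y : Fin (n r)), (e = eX x ∨ e = eY x) →
      (e = eX y ∨ e = eY y) → x = y := by
    intro e x y h1 h3
    rcases h1 with rfl | rfl <;> rcases h3 with h3 | h3
    · have h' := Sym2.congr_right.1 (congrArg Subtype.val h3)
      simpa using h'
    · exact absurd h3 (hXYne x y)
    · exact absurd h3.symm (hXYne y x)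
    · have h' := Sym2.congr_right.1 (congrArg Subtype.val h3)
      simpa using h'
  have hcol : ∀ e, c e ∈ colors c := fun e => mem_colors.2 ⟨e, rfl⟩
  -- exactly two edges of every triangle of the book have the same color
  have htri : ∀ x, (c (eX x) = c (eY x) ∨ c (eX x) = c g ∨ c (eY x) = c g) := by
    intro x
    obtain ⟨t, ht⟩ := exists_transversal_vertex hpos ⟨r, x⟩
    obtain ⟨a, ha, hat⟩ := exists_color_of_not_hasRainbow hc t
    have h2 := card_of_two_le_ecount hat
    obtain ⟨e, he, f, hf, hef, het, hft⟩ := exists_of_two_le_ecount hat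
    have hcase : ∀ e ∈ colorClass c a, (∀ v ∈ e, t v.1 = v.2) →
        e = g ∨ e = eX x ∨ e = eY x := by
      intro e he het
      rcases hform a ha h2 e he with h | ⟨y, h | h⟩
      · exact Or.inl h
      · have : y = x := (het ⟨r, y⟩ (by simp [h])).symm.trans ht
        subst this
        exact Or.inr (Or.inl h)
      · have : y = x := (het ⟨r, y⟩ (by simp [h])).symm.trans ht
        subst this
        exact Or.inr (Or.inr h)
    rcases hcase e he het with rfl | rfl | rfl <;> rcases hcase f hf hft with rfl | rfl | rfl <;>
      rw [coe_mem_colorClass] at he hf <;> simp [he, hf] at hef ⊢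
  have hntri : ∀ x, ¬ (c (eX x) = c g ∧ c (eY x) = c g) := by
    rintro x ⟨h1, h2⟩
    exact hboth (c g) (hcol g) (two_le_card_colorClass h1.symm (hXne x).symm)
      (coe_mem_colorClass.2 rfl : (g : Sym2 _) ∈ colorClass c (c g)) x
      ⟨(coe_mem_colorClass (e := eX x)).2 h1, (coe_mem_colorClass (e := eY x)).2 h2⟩
  -- equal colors outside of the class of the spine determine the page
  have hpage : ∀ (e f : (multipartite n).edgeSet) (x y : Fin (n r)), (e = eX x ∨ e = eY x) →
      (f = eX y ∨ f = eY y) → c e = c f → c e ≠ c g → x = y := by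
    intro e f x y he hf hef hne
    by_cases h : e = f
    · subst h
      exact hinj e x y he hf
    · obtain ⟨z, hz⟩ := hnot (c e) (hcol e) (two_le_card_colorClass hef h)
        (fun h' => hne ((hmem e g).2 h'))
      have hpg : ∀ e : (multipartite n).edgeSet,
          ((e : Sym2 _) = s(X, ⟨r, z⟩) ∨ (e : Sym2 _) = s(Y, ⟨r, z⟩)) → e = eX z ∨ e = eY z :=
        fun e hz => hz.imp (fun h => Subtype.ext h) (fun h => Subtype.ext h)
      rw [hinj e x z he (hpg e (hz e (coe_mem_colorClass.2 rfl))),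
        hinj f y z hf (hpg f (hz f ((hmem e f).1 hef)))]
  classical
  -- The color of a page is the color of one of its two edges that differs from the color of the
  -- spine; by `hntri` such an edge exists, and by `hpage` different pages get different colors.
  refine ⟨r, hrX.symm, hrY.symm, hrm, ⟨fun x => if c (eX x) = c g then c (eY x) else c (eX x),
    ?_, ?_, ?_⟩, ?_⟩
  · intro x y hxy
    simp only at hxy
    have hx := hntri x
    have hy := hntri y
    split_ifs at hxy with h1 h3 h3
    · exact hpage _ _ x y (Or.inr rfl) (Or.inr rfl) hxy (fun h => hx ⟨h1, h⟩)
    · exact hpage _ _ x y (Or.inr rfl) (Or.inl rfl) hxy (fun h => hx ⟨h1, h⟩)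
    · exact hpage _ _ x y (Or.inl rfl) (Or.inr rfl) hxy h1
    · exact hpage _ _ x y (Or.inl rfl) (Or.inl rfl) hxy h1
  · intro x
    have hx := hntri x
    dsimp only
    split_ifs with h1
    · exact fun h => hx ⟨h1, h⟩
    · exact h1
  · intro x
    change (c (eX x) = _ ∧ c (eY x) = _) ∨ (c (eX x) = _ ∧ c (eY x) = _) ∨
      (c (eX x) = _ ∧ c (eY x) = _)
    dsimp only
    split_ifs with h1
    · exact Or.inr (Or.inr ⟨h1, rfl⟩)
    · rcases htri x with h | h | h
      · exact Or.inl ⟨rfl, h.symm⟩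
      · exact absurd h h1
      · exact Or.inr (Or.inl ⟨rfl, h⟩)
  · intro e f hef
    by_cases h : e = f
    · exact Or.inl h
    right
    have h2 := two_le_card_colorClass hef h
    have hv : ∀ e' : Sym2 (Σ i, Fin (n i)), e' ∈ colorClass c (c e) →
        ∀ v ∈ e', v = X ∨ v = Y ∨ v.1 = r := by
      intro e' he' v hv
      rcases hform _ (hcol e) h2 e' he' with rfl | ⟨x, rfl | rfl⟩ <;>
      · rw [Sym2.mem_iff] at hv
        rcases hv with rfl | rfl <;> simp
    exact ⟨hv _ (coe_mem_colorClass.2 rfl), hv _ ((hmem e f).1 hef)⟩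

end TypeTwo

/-! ### Placing the book in the last three parts, the case of one lost color, and the conclusion. -/

section MainProof

variable {k : ℕ} {n : Fin k → ℕ}

theorem transport_mk (c : (multipartite n).EdgeLabeling ℕ) (ρ : multipartite n ≃g multipartite n)
    {v w v' w' : Σ i, Fin (n i)} (hv : ρ v = v') (hw : ρ w = w') (h : (multipartite n).Adj v' w')
    (h' : (multipartite n).Adj v w) : transport c ρ ⟨s(v', w'), h⟩ = c ⟨s(v, w), h'⟩ := by
  subst hv hw
  exact transport_apply c ρ ⟨s(v, w), h'⟩

theorem fromEnd_ne {i j : ℕ} (hi : i < k) (hj : j < k) (h : i ≠ j) :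
    (fromEnd i hi : Fin k) ≠ fromEnd j hj := by
  intro h'
  have := congrArg Fin.val h'
  simp only [fromEnd, Fin.val_rev] at this
  omega

theorem apply_fromEnd_le (hn : Antitone n) {i j : ℕ} (hi : i < k) (hj : j < k) (h : i ≤ j) :
    n (fromEnd i hi) ≤ n (fromEnd j hj) := by
  apply hn
  rw [Fin.le_def]
  simp only [fromEnd, Fin.val_rev]
  omega

/-- The embedding of the book that is spanned by the last three partite sets, if the last two are
single vertices. -/
def bookEmbedding (hpos : ∀ i, 0 < n i) (hk : 3 ≤ k) :
    book (n (fromEnd 2 (by omega))) ↪g multipartite n where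
  toFun
    | .x => firstVertex hpos 0 (by omega)
    | .y => firstVertex hpos 1 (by omega)
    | .z i => ⟨fromEnd 2 (by omega), i⟩
  inj' := by
    rintro (_ | _ | i) (_ | _ | j) h
    all_goals first
      | rfl
      | (have h' := congrArg (fun v => (v.1 : ℕ)) h
         simp only [firstVertex, fromEnd, Fin.val_rev] at h'
         omega)
      | (simp only [Sigma.mk.injEq, heq_eq_eq, true_and] at h
         rw [h])
  map_rel_iff' := by
    rintro (_ | _ | i) (_ | _ | j)
    all_goals
      refine multipartite_adj.trans ?_
      first
        | exact iff_of_true (fromEnd_ne _ _ (by omega)) trivial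
        | exact iff_of_false (fun h => h rfl) id

theorem range_bookEmbedding (hpos : ∀ i, 0 < n i) (hk : 3 ≤ k)
    (h0 : n (fromEnd 0 (by omega)) = 1) (h1 : n (fromEnd 1 (by omega)) = 1) :
    Set.range (bookEmbedding hpos hk) = lastThree hk := by
  ext v
  constructor
  · rintro ⟨_ | _ | i, rfl⟩
    · exact Or.inr (Or.inr rfl)
    · exact Or.inr (Or.inl rfl)
    · exact Or.inl rfl
  · rintro (h | h | h)
    · obtain ⟨i, x⟩ := v
      subst h
      exact ⟨.z x, rfl⟩
    · exact ⟨.y, eq_of_unit_part h1 rfl h⟩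
    · exact ⟨.x, eq_of_unit_part h0 rfl h⟩

theorem exists_isType2 (hpos : ∀ i, 0 < n i) (hk : 3 ≤ k)
    (h0 : n (fromEnd 0 (by omega)) = 1) (h1 : n (fromEnd 1 (by omega)) = 1)
    {c : (multipartite n).EdgeLabeling ℕ} {X Y : Σ i, Fin (n i)}
    (hX : X = firstVertex hpos 0 (by omega)) (hY : Y = firstVertex hpos 1 (by omega))
    (hXY : X.1 ≠ Y.1) {r : Fin k} (hrX : X.1 ≠ r) (hrY : Y.1 ≠ r)
    (hr : n r = n (fromEnd 2 (by omega)))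
    {a : Fin (n r) → ℕ} (ha : Function.Injective a)
    (ha0 : ∀ x, a x ≠ c ⟨s(X, Y), multipartite_adj.2 hXY⟩)
    (hpages : ∀ x, (c ⟨s(X, ⟨r, x⟩), multipartite_adj.2 hrX⟩ = a x ∧
          c ⟨s(Y, ⟨r, x⟩), multipartite_adj.2 hrY⟩ = a x) ∨
        (c ⟨s(X, ⟨r, x⟩), multipartite_adj.2 hrX⟩ = a x ∧
          c ⟨s(Y, ⟨r, x⟩), multipartite_adj.2 hrY⟩ = c ⟨s(X, Y), multipartite_adj.2 hXY⟩) ∨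
        (c ⟨s(X, ⟨r, x⟩), multipartite_adj.2 hrX⟩ = c ⟨s(X, Y), multipartite_adj.2 hXY⟩ ∧
          c ⟨s(Y, ⟨r, x⟩), multipartite_adj.2 hrY⟩ = a x))
    (hrest : ∀ e f : (multipartite n).edgeSet, c e = c f → e = f ∨
        ((∀ v ∈ (e : Sym2 _), v = X ∨ v = Y ∨ v.1 = r) ∧
          ∀ v ∈ (f : Sym2 _), v = X ∨ v = Y ∨ v.1 = r)) :
    ∃ c' : (multipartite n).EdgeLabeling ℕ, ColoredIso c c' ∧ IsType2 hk c' := by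
  have hXq : X.1 ≠ fromEnd 2 (by omega) := by
    rw [hX]; exact fromEnd_ne _ _ (by omega)
  have hYq : Y.1 ≠ fromEnd 2 (by omega) := by
    rw [hY]; exact fromEnd_ne _ _ (by omega)
  set q : Fin k := fromEnd 2 (by omega) with hq
  have hπ := swap_size (n := n) hr
  set ρ := permIso (Equiv.swap r q) hπ with hρ
  have hρX : ρ X = X := vertex_ext (Equiv.swap_apply_of_ne_of_ne hrX hXq) rfl
  have hρY : ρ Y = Y := vertex_ext (Equiv.swap_apply_of_ne_of_ne hrY hYq) rfl
  have hρz : ∀ i : Fin (n q), ρ ⟨r, Fin.cast hr.symm i⟩ = ⟨q, i⟩ := fun i =>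
    vertex_ext (Equiv.swap_apply_left r q) rfl
  have hrange := range_bookEmbedding hpos hk h0 h1
  have hφx : bookEmbedding hpos hk .x = X := hX.symm
  have hφy : bookEmbedding hpos hk .y = Y := hY.symm
  have hφz : ∀ i, bookEmbedding hpos hk (.z i) = ⟨q, i⟩ := fun i => rfl
  refine ⟨transport c ρ, coloredIso_transport _ _, h1, bookEmbedding hpos hk, hrange,
    ⟨c ⟨s(X, Y), multipartite_adj.2 hXY⟩, fun i => a (Fin.cast hr.symm i), ?_, fun i => ha0 _,
      ?_, fun i => ?_⟩, fun e f hef => ?_⟩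
  · intro i j hij
    exact Fin.cast_injective _ (ha hij)
  · exact transport_mk c ρ (hρX.trans hφx.symm) (hρY.trans hφy.symm) _ _
  · have e1 : ((transport c ρ).pullback (bookEmbedding hpos hk).toHom).get .x (.z i) trivial =
        c ⟨s(X, ⟨r, Fin.cast hr.symm i⟩), multipartite_adj.2 hrX⟩ :=
      transport_mk c ρ (hρX.trans hφx.symm) ((hρz i).trans (hφz i).symm) _ _
    have e2 : ((transport c ρ).pullback (bookEmbedding hpos hk).toHom).get .y (.z i) trivial =
        c ⟨s(Y, ⟨r, Fin.cast hr.symm i⟩), multipartite_adj.2 hrY⟩ :=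
      transport_mk c ρ (hρY.trans hφy.symm) ((hρz i).trans (hφz i).symm) _ _
    rw [e1, e2]
    exact hpages _
  · obtain ⟨e, rfl⟩ := ρ.mapEdgeSet.surjective e
    obtain ⟨f, rfl⟩ := ρ.mapEdgeSet.surjective f
    rw [transport_apply, transport_apply] at hef
    have hv : ∀ e : (multipartite n).edgeSet, (∀ v ∈ (e : Sym2 _), v = X ∨ v = Y ∨ v.1 = r) →
        ∀ v ∈ (ρ.mapEdgeSet e : Sym2 _), v ∈ Set.range (bookEmbedding hpos hk) := by
      intro e he v hv
      rw [coe_mapEdgeSet, Sym2.mem_map] at hv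
      obtain ⟨w, hw, rfl⟩ := hv
      rw [hrange]
      rcases he w hw with rfl | rfl | h
      · rw [hρX, hX]; exact Or.inr (Or.inr rfl)
      · rw [hρY, hY]; exact Or.inr (Or.inl rfl)
      · left
        rw [hρ, permIso_fst, h, Equiv.swap_apply_left]
    rcases hrest e f hef with h | ⟨h, h'⟩
    · left; rw [h]
    · exact Or.inr ⟨hv e h, hv f h'⟩

/-- A vertex on all transversals is alone in its partite set. -/
theorem unit_of_forall_transversal {v : Σ i, Fin (n i)}
    (h : ∀ t : ∀ i, Fin (n i), t v.1 = v.2) (hpos : ∀ i, 0 < n i) : n v.1 = 1 := by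
  refine le_antisymm ?_ (hpos _)
  by_contra! hlt
  have : Nontrivial (Fin (n v.1)) := Fin.nontrivial_iff_two_le.2 hlt
  obtain ⟨x, hx⟩ := exists_ne v.2
  have := h (Function.update (fun i => ⟨0, hpos i⟩) v.1 x)
  rw [Function.update_self] at this
  exact hx this

/-- An extremal coloring that loses only one color. -/
theorem exists_type_of_pair (hk : 3 ≤ k) (hn : Antitone n) (hpos : ∀ i, 0 < n i)
    {c : (multipartite n).EdgeLabeling ℕ} (hc : ¬ HasRainbow c (completeGraph (Fin k)))
    (hq : n (fromEnd 2 (by omega)) = 1)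
    (huniq : ∀ t, ∀ a ∈ colors c, ∀ b ∈ colors c, 2 ≤ ecount (colorClass c a) t →
      2 ≤ ecount (colorClass c b) t → a = b)
    (htight : ∀ a ∈ colors c,
      mean (fun t => (ind (2 ≤ ecount (colorClass c a) t) : ℚ)) = #(colorClass c a) - 1) :
    ∃ c' : (multipartite n).EdgeLabeling ℕ, ColoredIso c c' ∧
      (IsType1 hpos c' ∨ IsType2 hk c' ∨ IsType3 hk c') := by
  classical
  obtain ⟨a, ha, hat⟩ := exists_color_of_not_hasRainbow hc fun i => ⟨0, hpos i⟩
  have h2 := card_of_two_le_ecount hat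
  have ht := htight a ha
  have hle1 := mean_ind_le_one hpos fun t => 2 ≤ ecount (colorClass c a) t
  -- Tightness with constant 1 says that the probability equals `|F| - 1`, so `|F| ≤ 2`; for `|F| =
  -- 2` the probability is 1, and both edges lie on all transversals.
  have hcard : #(colorClass c a) = 2 := by
    have : (#(colorClass c a) : ℚ) ≤ 2 := by linarith
    have : #(colorClass c a) ≤ 2 := by exact_mod_cast this
    omega
  have hall : ∀ t, 2 ≤ ecount (colorClass c a) t := by
    intro t
    have h := eq_of_mean_le hpos (f := fun t => (ind (2 ≤ ecount (colorClass c a) t) : ℚ))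
      (g := fun _ => 1) (fun t => by exact_mod_cast ind_le_one _)
      (by rw [mean_const hpos, ht, hcard]; norm_num) t
    exact ind_eq_one.1 (by exact_mod_cast h)
  obtain ⟨e, f, hef, hF⟩ := card_eq_two.1 hcard
  have hhit : ∀ t : ∀ i, Fin (n i), (∀ v ∈ e, t v.1 = v.2) ∧ ∀ v ∈ f, t v.1 = v.2 := by
    intro t
    obtain ⟨e', he', f', hf', hef', het, hft⟩ := exists_of_two_le_ecount (hall t)
    rw [hF, mem_insert, mem_singleton] at he' hf'
    rcases he' with rfl | rfl <;> rcases hf' with rfl | rfl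
    · exact absurd rfl hef'
    · exact ⟨het, hft⟩
    · exact ⟨hft, het⟩
    · exact absurd rfl hef'
  have hunit_e : ∀ v ∈ e, n v.1 = 1 := fun v hv =>
    unit_of_forall_transversal (fun t => (hhit t).1 v hv) hpos
  have hunit_f : ∀ v ∈ f, n v.1 = 1 := fun v hv =>
    unit_of_forall_transversal (fun t => (hhit t).2 v hv) hpos
  -- Every transversal already carries the color `a` twice, so any other class has probability 0,
  -- and tightness makes it a single edge.
  have honly : ∀ b ∈ colors c, 2 ≤ #(colorClass c b) → b = a := by
    intro b hb hb2
    by_contra hne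
    have hz : ∀ t, ind (2 ≤ ecount (colorClass c b) t) = 0 := fun t =>
      ind_not fun h => hne (huniq t b hb a ha h (hall t))
    have := htight b hb
    simp only [hz, Nat.cast_zero, mean_const hpos] at this
    have hb2' : (2 : ℚ) ≤ #(colorClass c b) := by exact_mod_cast hb2
    linarith
  have hcr := crossing_colorClass c a
  have he : e ∈ colorClass c a := by rw [hF]; simp
  have hf : f ∈ colorClass c a := by rw [hF]; simp
  -- All ends are unit parts. Two edges with a common end form a full star, and two disjoint edges
  -- occupy four unit parts.
  by_cases hdisj : ∃ y, y ∈ e ∧ y ∈ f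
  · obtain ⟨y, hye, hyf⟩ := hdisj
    obtain ⟨v, rfl⟩ := Sym2.mem_iff_exists.1 hye
    obtain ⟨w, rfl⟩ := Sym2.mem_iff_exists.1 hyf
    have hv1 := hunit_e v (by simp)
    have hw1 := hunit_f w (by simp)
    have hy1 := hunit_e y (by simp)
    have hvw : v.1 ≠ w.1 := fun h => hef (by rw [eq_of_unit_part hw1 h rfl])
    have h0 : n (fromEnd 0 (by omega)) = 1 :=
      le_antisymm ((apply_fromEnd_le hn _ _ (by omega)).trans hq.le) (hpos _)
    have h1 : n (fromEnd 1 (by omega)) = 1 :=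
      le_antisymm ((apply_fromEnd_le hn _ _ (by omega)).trans hq.le) (hpos _)
    have hstar : ∀ b ∈ colors c, 2 ≤ #(colorClass c b) → IsFullStar (colorClass c b)
        (n (fromEnd 0 (by omega))) (n (fromEnd 2 (by omega)) + n (fromEnd 1 (by omega))) := by
      intro b hb hb2
      rw [honly b hb hb2]
      refine ⟨y, v.1, w.1, hvw, hcr _ _ he, hcr _ _ hf, by omega, by omega, fun e => ?_⟩
      rw [hF, mem_insert, mem_singleton]
      constructor
      · rintro (rfl | rfl)
        · exact ⟨v, Or.inl rfl, rfl⟩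
        · exact ⟨w, Or.inr rfl, rfl⟩
      · rintro ⟨z, hz | hz, rfl⟩
        · left; rw [eq_of_unit_part hv1 hz rfl]
        · right; rw [eq_of_unit_part hw1 hz rfl]
    obtain ⟨p, hp, i, j, hij, hcc⟩ := exists_center_part hpos hc huniq hstar
    obtain ⟨c', h, h'⟩ := exists_isType3 hk hp hij hcc
    exact ⟨c', h, Or.inr (Or.inr h')⟩
  · induction e with | _ v₀ v₁ =>
    induction f with | _ v₂ v₃ =>
    push Not at hdisj
    have hne : ∀ v w : Σ i, Fin (n i), v ∈ s(v₀, v₁) → w ∈ s(v₂, v₃) → v.1 ≠ w.1 := by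
      intro v w hv hw h
      have : v = w := eq_of_unit_part (hunit_f w hw) h rfl
      subst this
      exact hdisj v hv hw
    have d01 := hcr _ _ he
    have d23 := hcr _ _ hf
    have d02 := hne v₀ v₂ (by simp) (by simp)
    have d03 := hne v₀ v₃ (by simp) (by simp)
    have d12 := hne v₁ v₂ (by simp) (by simp)
    have d13 := hne v₁ v₃ (by simp) (by simp)
    suffices H : ∃ c' : (multipartite n).EdgeLabeling ℕ, ColoredIso c c' ∧ IsType1 hpos c' by
      obtain ⟨c', h, h'⟩ := H
      exact ⟨c', h, Or.inl h'⟩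
    refine exists_isType1 hn hpos (v := ![v₀, v₁, v₂, v₃]) ?_ ?_ ?_
    · intro x y hxy
      fin_cases x <;> fin_cases y <;> first
        | rfl
        | exact absurd hxy ‹_›
        | exact absurd hxy.symm ‹_›
    · intro x
      fin_cases x
      · exact hunit_e v₀ (by simp)
      · exact hunit_e v₁ (by simp)
      · exact hunit_f v₂ (by simp)
      · exact hunit_f v₃ (by simp)
    · intro e' f'
      have hmem : ∀ g : (multipartite n).edgeSet, c g = a ↔
          (g : Sym2 _) = s(v₀, v₁) ∨ (g : Sym2 _) = s(v₂, v₃) := by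
        intro g
        rw [← coe_mem_colorClass, hF, mem_insert, mem_singleton]
      change c e' = c f' ↔ e' = f' ∨ ((e' : Sym2 _) = s(v₀, v₁) ∧ (f' : Sym2 _) = s(v₂, v₃)) ∨
        ((f' : Sym2 _) = s(v₀, v₁) ∧ (e' : Sym2 _) = s(v₂, v₃))
      constructor
      · intro h
        by_cases hne' : e' = f'
        · exact Or.inl hne'
        have hca := honly _ (mem_colors.2 ⟨e', rfl⟩) (two_le_card_colorClass h hne')
        rcases (hmem e').1 hca with h1 | h1 <;> rcases (hmem f').1 (h ▸ hca) with h3 | h3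
        · exact absurd (Subtype.ext (h1.trans h3.symm)) hne'
        · exact Or.inr (Or.inl ⟨h1, h3⟩)
        · exact Or.inr (Or.inr ⟨h3, h1⟩)
        · exact absurd (Subtype.ext (h1.trans h3.symm)) hne'
      · rintro (rfl | ⟨h1, h3⟩ | ⟨h1, h3⟩)
        · rfl
        · rw [(hmem e').2 (Or.inl h1), (hmem f').2 (Or.inr h3)]
        · rw [(hmem e').2 (Or.inr h3), (hmem f').2 (Or.inl h1)]

end MainProof

end AntiRamsey

theorem mainTheorem4 (k : ℕ) (hk : 3 ≤ k) (n : Fin k → ℕ) (hn : Antitone n)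
    (hpos : ∀ i, 0 < n i) (c : (AntiRamsey.multipartite n).EdgeLabeling ℕ)
    (hc : AntiRamsey.IsExtremal c (SimpleGraph.completeGraph (Fin k))) :
    ∃ c' : (AntiRamsey.multipartite n).EdgeLabeling ℕ, AntiRamsey.ColoredIso c c' ∧
      (AntiRamsey.IsType1 hpos c' ∨ AntiRamsey.IsType2 hk c' ∨ AntiRamsey.IsType3 hk c') := by
  open AntiRamsey in
  have hκl : (fromEnd 0 (by omega) : Fin k) ≠ fromEnd 1 (by omega) := fromEnd_ne _ _ (by omega)
  have hκq : (fromEnd 0 (by omega) : Fin k) ≠ fromEnd 2 (by omega) := fromEnd_ne _ _ (by omega)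
  have hlq : (fromEnd 1 (by omega) : Fin k) ≠ fromEnd 2 (by omega) := fromEnd_ne _ _ (by omega)
  have hcb : n (fromEnd 0 (by omega)) ≤ n (fromEnd 1 (by omega)) :=
    apply_fromEnd_le hn _ _ (by omega)
  have hba : n (fromEnd 1 (by omega)) ≤ n (fromEnd 2 (by omega)) :=
    apply_fromEnd_le hn _ _ (by omega)
  have hrest : ∀ i : Fin k, i ≠ fromEnd 0 (by omega) → i ≠ fromEnd 1 (by omega) →
      n (fromEnd 2 (by omega)) ≤ n i := by
    intro i h0 h1
    apply hn
    rw [Ne, Fin.ext_iff] at h0 h1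
    rw [Fin.le_def]
    simp only [fromEnd, Fin.val_rev] at h0 h1 ⊢
    omega
  have hnum := card_le_of_isExtremal hpos hκq hκl hlq.symm hc
  have hnr := hc.1
  -- The equality case of `class_bound` needs all sizes but the smallest to be at least 2. Otherwise
  -- the last two parts are single vertices, `N` becomes `n_{k-2}`, and `unit_bound` takes over.
  rcases le_or_gt 2 (n (fromEnd 1 (by omega))) with hb2 | hb1
  · have hcb' : ∀ a ∈ colors c, _ := fun a ha =>
      class_bound hpos Finset.univ _ _ _ (Finset.mem_univ _) (Finset.mem_univ _) hκl hcb hba hb2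
        (fun i _ => hrest i) (colorClass c a) (colorClass_nonempty ha) (crossing_colorClass c a)
        (fun _ _ _ _ => Finset.mem_univ _)
    have hcq : (1 : ℚ) ≤ n (fromEnd 0 (by omega)) := by exact_mod_cast hpos _
    have hbq : (2 : ℚ) ≤ n (fromEnd 1 (by omega)) := by exact_mod_cast hb2
    have haq : (0 : ℚ) ≤ n (fromEnd 2 (by omega)) := by positivity
    obtain ⟨htight, huniq⟩ := tight_of_bound hpos hnr
      (mul_pos (by linarith) (by linarith)) (fun a ha => (hcb' a ha).1) (by
        have h : (Nat.card (multipartite n).edgeSet : ℚ) ≤ ((numColors c +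
          n (fromEnd 0 (by omega)) * (n (fromEnd 2 (by omega)) + n (fromEnd 1 (by omega)) - 1) : ℕ) : ℚ) := by
          exact_mod_cast hnum
        rw [Nat.cast_add, Nat.cast_mul, Nat.cast_sub (by omega), Nat.cast_add, Nat.cast_one] at h
        exact h)
    obtain ⟨p, hp, i, j, hij, hcc⟩ := exists_center_part hpos hnr huniq
      (fun a ha h2 => (hcb' a ha).2 h2 (htight a ha))
    obtain ⟨c', h, h'⟩ := exists_isType3 hk hp hij hcc
    exact ⟨c', h, Or.inr (Or.inr h')⟩
  · have h1 : n (fromEnd 1 (by omega)) = 1 := le_antisymm (by omega) (hpos _)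
    have h0 : n (fromEnd 0 (by omega)) = 1 := le_antisymm (by omega) (hpos _)
    have hcb' : ∀ a ∈ colors c, _ := fun a ha =>
      unit_bound hpos (X := firstVertex hpos 0 (by omega)) (Y := firstVertex hpos 1 (by omega))
        h0 h1 (hpos (fromEnd 2 (by omega))) hrest (colorClass_nonempty ha)
        (crossing_colorClass c a)
    obtain ⟨htight, huniq⟩ := tight_of_bound hpos hnr
      (by exact_mod_cast hpos (fromEnd 2 (by omega))) (fun a ha => (hcb' a ha).1) (by
        rw [h0, h1, one_mul, Nat.add_sub_cancel] at hnum
        exact_mod_cast hnum)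
    rcases le_or_gt 2 (n (fromEnd 2 (by omega))) with ha2 | ha1
    · obtain ⟨r, hrX, hrY, hr, ⟨a, ha, ha0, hpages⟩, hout⟩ := exists_book hpos hnr huniq hκl
        (X := firstVertex hpos 0 (by omega)) (Y := firstVertex hpos 1 (by omega))
        (fun a ha h2 => book_class hpos h0 h1 ha2 hrest (crossing_colorClass c a) h2 (htight a ha))
      obtain ⟨c', h, h'⟩ := exists_isType2 hpos hk h0 h1 rfl rfl hκl hrX hrY hr ha ha0 hpages hout
      exact ⟨c', h, Or.inr (Or.inl h')⟩
    · have hq : n (fromEnd 2 (by omega)) = 1 := le_antisymm (by omega) (hpos _)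
      refine exists_type_of_pair hk hn hpos hnr hq huniq fun a ha => ?_
      rw [← htight a ha, hq, Nat.cast_one, one_mul]
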